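/- Let $k$ be an algebraically closed field and $n\ge 0$ an integer. **The category $\mathrm{Bas}_n$.** An object is a unital associative finite-dimensional $k$-algebra $A$ with $A/\operatorname{rad}A\simeq k^{n}$ as $k$-algebras, together with an ordering $\alpha_1,\dots,\alpha_n$ of its $n$ pairwise different $k$-algebra homomorphisms $A\to k$ (such algebras are the basic ones). A morphism $A\to A'$ is a conjugacy class of unital $k$-algebra homomorphisms $\psi\colon A\to A'$ with $\alpha'_i\circ\psi=\alpha_i$ for all $i$, where $\varphi$ and $\psi$ are conjugate if $\varphi=u\psi u^{-1}$ for some invertible $u\in A'$. **The category $\mathrm{Fin}_n$.** An object is an essentially small $k$-linear abelian category $\mathcal A$ such that every object has finite length, $\dim_k\operatorname{Hom}_{\mathcal A}(M,M')$ and $\dim_k\operatorname{Ext}^1_{\mathcal A}(M,M')$ are finite for all $M,M'\in\mathcal A$, and $\mathcal A$ has a projective generator, together with an ordering $S_1^{\mathcal A},\dots,S_n^{\mathcal A}$ of its isomorphism classes of simple objects, of which there are exactly $n$. A morphism $\mathcal A\to\mathcal B$ is an isomorphism class of exact $k$-linear functors $\mathcal A\to\mathcal B$ that take $S_i^{\mathcal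 A}$ to $S_i^{\mathcal B}$ for $i=1,\dots,n$. **Theorem 9.3.** For $A\in\mathrm{Bas}_n$ let $\Upsilon(A)=\mathrm{mod}_{\mathrm{fd}}\text{-}A$ be the category of finite-dimensional right $A$-modules, with $S_i$ the class of the one-dimensional module $k$ on which $A$ acts through $\alpha_i$; for the class of a compatible homomorphism $\beta\colon A\to B$ let $\Upsilon(\beta)$ be the class of the restriction functor $\beta_*\colon\mathrm{mod}_{\mathrm{fd}}\text{-}B\to\mathrm{mod}_{\mathrm{fd}}\text{-}A$. Then $\Upsilon$ is a well-defined functor $\mathrm{Bas}_n^{\mathrm{op}}\to\mathrm{Fin}_n$, and it is an equivalence of categories. -/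

import Mathlib

open CategoryTheory CategoryTheory.Limits

universe u

namespace PointedDef

noncomputable section

/-! ### Basic algebras with ordered characters -/

/-- A basic finite-dimensional unital `k`-algebra `A` (associative, not necessarily commutative)
with `A / rad A ≃ k ^ n`, together with an ordering `α 0, …, α (n - 1)` of its `n` pairwise
different characters `A → k`. -/
structure Bas (k : Type u) [Field k] (n : ℕ) : Type (u + 1) where
  carrier : Type u
  [ring : Ring carrier]
  [algebra : Algebra k carrier]
  [finite : Module.Finite k carrier]
  quotient_radical : Nonempty ((carrier ⧸ Ring.jacobson carrier) ≃ₐ[k] (Fin n → k))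
  char : Fin n → (carrier →ₐ[k] k)
  char_injective : Function.Injective char

attribute [instance] Bas.ring Bas.algebra Bas.finite

namespace Bas

variable {k : Type u} [Field k] {n : ℕ}

instance : CoeSort (Bas k n) (Type u) := ⟨Bas.carrier⟩

/-- Homomorphisms of unital `k`-algebras compatible with the ordered characters. -/
structure AlgHomOver (A B : Bas k n) : Type u where
  hom : A →ₐ[k] B
  char_comp : ∀ i, (B.char i).comp hom = A.char i

/-- `φ` and `ψ` are conjugate if `φ = u ψ u⁻¹` for some invertible `u` of the target. -/
def Conj {A B : Bas k n} (φ ψ : AlgHomOver A B) : Prop :=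
  ∃ v : (B : Type u)ˣ, ∀ a, φ.hom a = v * ψ.hom a * (v⁻¹ : (B : Type u)ˣ)

/-- Conjugacy is an equivalence relation. -/
def conjSetoid (A B : Bas k n) : Setoid (AlgHomOver A B) where
  r := Conj
  iseqv :=
    { refl := fun φ => ⟨1, fun a => by simp⟩
      symm := by
        rintro φ ψ ⟨v, hv⟩
        exact ⟨v⁻¹, fun a => by simp [hv, mul_assoc]⟩
      trans := by
        rintro φ ψ χ ⟨v, hv⟩ ⟨w, hw⟩
        exact ⟨v * w, fun a => by simp [hv, hw, mul_assoc]⟩ }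

/-- The identity homomorphism. -/
def AlgHomOver.id (A : Bas k n) : AlgHomOver A A := ⟨AlgHom.id k A, fun _ => rfl⟩

/-- Composition of compatible homomorphisms: first `φ`, then `ψ`. -/
def AlgHomOver.comp {A B C : Bas k n} (φ : AlgHomOver A B) (ψ : AlgHomOver B C) :
    AlgHomOver A C :=
  ⟨ψ.hom.comp φ.hom, fun i => by rw [← AlgHom.comp_assoc, ψ.char_comp, φ.char_comp]⟩

lemma AlgHomOver.comp_conj {A B C : Bas k n} {φ φ' : AlgHomOver A B} {ψ ψ' : AlgHomOver B C}
    (h : Conj φ φ') (h' : Conj ψ ψ') : Conj (φ.comp ψ) (φ'.comp ψ') := by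
  obtain ⟨v, hv⟩ := h
  obtain ⟨w, hw⟩ := h'
  refine ⟨w * Units.map (ψ'.hom : B →* C) v, fun a => ?_⟩
  change ψ.hom (φ.hom a) = _ * ψ'.hom (φ'.hom a) * _
  rw [hw, hv, mul_inv_rev, ← map_inv]
  simp [mul_assoc]

/-- Morphisms are the conjugacy classes of compatible homomorphisms. -/
instance : Category.{u} (Bas k n) where
  Hom A B := Quotient (conjSetoid A B)
  id A := Quotient.mk (conjSetoid A A) (AlgHomOver.id A)
  comp {A B C} := Quotient.map₂ (sa := conjSetoid A B) (sb := conjSetoid B C)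
    (sc := conjSetoid A C) AlgHomOver.comp (fun _ _ h _ _ h' => AlgHomOver.comp_conj h h')
  id_comp := by rintro A B ⟨f⟩; rfl
  comp_id := by rintro A B ⟨f⟩; rfl
  assoc := by rintro A B C D ⟨f⟩ ⟨g⟩ ⟨h⟩; rfl

end Bas

/-! ### Linear abelian categories with a list of `n` isomorphism classes -/

/-- The isomorphism classes of objects of a category. -/
abbrev IsoClass (C : Type*) [Category* C] := Quotient (isIsomorphicSetoid C)

/-- The isomorphism class of an object. -/
abbrev isoClass {C : Type*} [Category* C] (X : C) : IsoClass C :=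
  Quotient.mk (isIsomorphicSetoid C) X

/-- The map on isomorphism classes induced by a functor. -/
def mapIsoClass {C D : Type*} [Category* C] [Category* D] (F : C ⥤ D) : IsoClass C → IsoClass D :=
  Quotient.map (sa := isIsomorphicSetoid C) (sb := isIsomorphicSetoid D) F.obj
    (fun _ _ h => h.map F.mapIso)

/-- A `k`-linear abelian category together with a list of `n` isomorphism classes of objects. -/
structure MarkedCat (k : Type u) [Field k] (n : ℕ) : Type (u + 2) where
  carrier : Type (u + 1)
  [category : Category.{u} carrier]
  [abelian : Abelian carrier]
  [linear : Linear k carrier]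
  marking : Fin n → IsoClass carrier

attribute [instance] MarkedCat.category MarkedCat.abelian MarkedCat.linear

namespace MarkedCat

variable {k : Type u} [Field k] {n : ℕ}

instance : CoeSort (MarkedCat k n) (Type (u + 1)) := ⟨MarkedCat.carrier⟩

/-- Exact `k`-linear functors taking the `i`-th class of the source to the `i`-th class of the
target. -/
structure ExactFun (C D : MarkedCat k n) : Type (u + 1) where
  functor : C ⥤ D
  preservesFiniteLimits : PreservesFiniteLimits functor
  preservesFiniteColimits : PreservesFiniteColimits functor
  linear : functor.Linear k
  map_marking : ∀ i, mapIsoClass functor (C.marking i) = D.marking i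

/-- Isomorphism of functors. -/
def isoSetoid (C D : MarkedCat k n) : Setoid (ExactFun C D) where
  r F G := Nonempty (F.functor ≅ G.functor)
  iseqv :=
    { refl := fun _ => ⟨Iso.refl _⟩
      symm := fun ⟨e⟩ => ⟨e.symm⟩
      trans := fun ⟨e⟩ ⟨e'⟩ => ⟨e ≪≫ e'⟩ }

lemma mapIsoClass_id {C : Type*} [Category* C] (x : IsoClass C) : mapIsoClass (𝟭 C) x = x := by
  induction x using Quotient.inductionOn; rfl

lemma mapIsoClass_comp {C D E : Type*} [Category* C] [Category* D] [Category* E]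
    (F : C ⥤ D) (G : D ⥤ E) (x : IsoClass C) :
    mapIsoClass (F ⋙ G) x = mapIsoClass G (mapIsoClass F x) := by
  induction x using Quotient.inductionOn; rfl

/-- The identity functor. -/
def ExactFun.id (C : MarkedCat k n) : ExactFun C C where
  functor := 𝟭 C
  preservesFiniteLimits := inferInstance
  preservesFiniteColimits := inferInstance
  linear := inferInstance
  map_marking _ := mapIsoClass_id _

/-- Composition of functors: first `F`, then `G`. -/
def ExactFun.comp {C D E : MarkedCat k n} (F : ExactFun C D) (G : ExactFun D E) :
    ExactFun C E where
  functor := F.functor ⋙ G.functor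
  preservesFiniteLimits :=
    have := F.preservesFiniteLimits
    have := G.preservesFiniteLimits
    comp_preservesFiniteLimits _ _
  preservesFiniteColimits :=
    have := F.preservesFiniteColimits
    have := G.preservesFiniteColimits
    comp_preservesFiniteColimits _ _
  linear :=
    have := F.linear
    have := G.linear
    inferInstance
  map_marking i := by rw [mapIsoClass_comp, F.map_marking, G.map_marking]

/-- Morphisms are the isomorphism classes of exact `k`-linear functors preserving the given
classes. -/
instance : Category.{u + 1} (MarkedCat k n) where
  Hom C D := Quotient (isoSetoid C D)
  id C := Quotient.mk (isoSetoid C C) (ExactFun.id C)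
  comp {C D E} := Quotient.map₂ (sa := isoSetoid C D) (sb := isoSetoid D E)
    (sc := isoSetoid C E) ExactFun.comp
    (fun _ _ ⟨e⟩ _ _ ⟨e'⟩ => ⟨Functor.isoWhiskerRight e _ ≪≫ Functor.isoWhiskerLeft _ e'⟩)
  id_comp := by rintro C D ⟨F⟩; exact Quotient.sound ⟨F.functor.leftUnitor⟩
  comp_id := by rintro C D ⟨F⟩; exact Quotient.sound ⟨F.functor.rightUnitor⟩
  assoc := by
    rintro C D E E' ⟨F⟩ ⟨G⟩ ⟨H⟩
    exact Quotient.sound ⟨Functor.associator F.functor G.functor H.functor⟩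

/-- The category is essentially small, finite (all objects have finite length, all `Hom` and `Ext¹`
are finite-dimensional over `k`, and there is a projective generator), and the given list
enumerates, without repetition, exactly the isomorphism classes of its simple objects. -/
structure IsFinite (C : MarkedCat k n) : Prop where
  essentiallySmall : EssentiallySmall.{u} C
  finite_length : ∀ X : C, IsNoetherianObject X ∧ IsArtinianObject X
  finite_hom : ∀ X Y : C, Module.Finite k (X ⟶ Y)
  finite_ext : ∀ X Y : C,
    letI : HasExt.{u + 1} C := HasExt.standard C
    Module.Finite k (Abelian.Ext.{u + 1} X Y 1)
  exists_projective_generator : ∃ P : C, Projective P ∧ IsSeparator P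
  marking_injective : Function.Injective C.marking
  simple_iff : ∀ X : C, Simple X ↔ ∃ i, C.marking i = isoClass X

end MarkedCat

/-- The category of finite `k`-linear abelian categories with `n` ordered isomorphism classes of
simple objects: a full subcategory of `MarkedCat k n`. -/
abbrev FinMarkedCat (k : Type u) [Field k] (n : ℕ) : Type (u + 2) :=
  ObjectProperty.FullSubcategory (fun C : MarkedCat k n => C.IsFinite)

/-! ### Finite-dimensional right modules and restriction functors -/

section Modules

open ModuleCat MulOpposite

variable {k : Type u} [Field k]

section

variable (k) (A : Type u) [Ring A] [Algebra k A]

/-- Right `A`-modules (modules over `Aᵐᵒᵖ`) that are finite-dimensional over `k`. -/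
def isFD : ObjectProperty (ModuleCat.{u} Aᵐᵒᵖ) := fun M => Module.Finite k M

instance : (isFD k A).IsClosedUnderSubobjects where
  prop_of_mono {X Y} f _ hY := by
    have : Module.Finite k Y := hY
    exact Module.Finite.of_injective (f.hom.restrictScalars k)
      ((ModuleCat.mono_iff_injective f).1 inferInstance)

instance : (isFD k A).IsClosedUnderQuotients where
  prop_of_epi {X Y} f _ hX := by
    have : Module.Finite k X := hX
    exact Module.Finite.of_surjective (f.hom.restrictScalars k)
      ((ModuleCat.epi_iff_surjective f).1 inferInstance)

instance : (isFD k A).ContainsZero where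
  exists_zero := ⟨ModuleCat.of Aᵐᵒᵖ PUnit, ModuleCat.isZero_of_subsingleton _,
    Module.Finite.of_surjective (0 : k →ₗ[k] _) (fun _ => ⟨0, Subsingleton.elim (α := PUnit) _ _⟩)⟩

instance : (isFD k A).IsClosedUnderFiniteProducts := by
  refine ⟨fun J _ => ⟨?_⟩⟩
  rintro X ⟨p, hp⟩
  have : ∀ j, Module.Finite k (p.diag.obj j) := hp
  have : Finite (Discrete J) := Finite.of_equiv J discreteEquiv.symm
  refine Module.Finite.of_injective
    (LinearMap.pi fun j => ((p.π.app j).hom.restrictScalars k :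
      X →ₗ[k] (p.diag.obj j))) (fun x y hxy => ?_)
  have : ModuleCat.ofHom (LinearMap.toSpanSingleton Aᵐᵒᵖ X x) =
      ModuleCat.ofHom (LinearMap.toSpanSingleton Aᵐᵒᵖ X y) := by
    refine p.isLimit.hom_ext fun j => ?_
    ext
    simpa using congrFun hxy j
  simpa using congrArg (fun f => f.hom 1) this

/-- The category of finite-dimensional right `A`-modules. -/
abbrev ModFD : Type (u + 1) := (isFD k A).FullSubcategory

end

variable {A B : Type u} [Ring A] [Algebra k A] [Ring B] [Algebra k B]

/-- Restriction of right modules along an algebra homomorphism `f : A → B`. -/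
abbrev restrictRight (f : A →ₐ[k] B) : ModuleCat.{u} Bᵐᵒᵖ ⥤ ModuleCat.{u} Aᵐᵒᵖ :=
  ModuleCat.restrictScalars (AlgHom.op f).toRingHom


lemma isFD_restrictRight (f : A →ₐ[k] B) (M : ModuleCat.{u} Bᵐᵒᵖ) (hM : isFD k B M) :
    isFD k A ((restrictRight f).obj M) := by
  have : Module.Finite k M := hM
  let e : M →ₗ[k] (restrictRight f).obj M :=
    { toFun := fun x => x
      map_add' := fun _ _ => rfl
      map_smul' := fun c x => congrArg (· • x) ((AlgHom.op f).commutes c).symm }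
  exact Module.Finite.of_surjective e (fun x => ⟨x, rfl⟩)

/-- The restriction functor `f_* : mod_fd-B ⥤ mod_fd-A` along `f : A → B`. -/
def restrictFD (f : A →ₐ[k] B) : ModFD k B ⥤ ModFD k A :=
  (isFD k A).lift ((isFD k B).ι ⋙ restrictRight f) fun M => isFD_restrictRight f M.obj M.property

instance (f : A →ₐ[k] B) : (restrictFD f).Additive where

instance (f : A →ₐ[k] B) : (restrictFD f).Linear k where
  map_smul g c := by
    ext1
    exact (restrictRight f).map_smul c g.hom

lemma restrictRight_exact (f : A →ₐ[k] B) :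
    PreservesFiniteLimits (restrictRight f) ∧ PreservesFiniteColimits (restrictRight f) := by
  refine ((Functor.exact_tfae (restrictRight f)).out 1 3).mp fun S h => ?_
  rw [ShortComplex.ShortExact.moduleCat_exact_iff_function_exact] at h ⊢
  exact h

variable (k A) in
lemma isFD_ι_exact : PreservesFiniteLimits (isFD k A).ι ∧ PreservesFiniteColimits (isFD k A).ι :=
  have := fun (X Y : ModFD k A) (f : X ⟶ Y) => (isFD k A).preservesKernels_ι f
  have := fun (X Y : ModFD k A) (f : X ⟶ Y) => (isFD k A).preservesCokernels_ι f
  ⟨Functor.preservesFiniteLimits_of_preservesKernels _,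
    Functor.preservesFiniteColimits_of_preservesCokernels _⟩

lemma restrictFD_preservesFiniteLimits (f : A →ₐ[k] B) : PreservesFiniteLimits (restrictFD f) :=
  have := (restrictRight_exact f).1
  have := (isFD_ι_exact k B).1
  have : PreservesFiniteLimits (restrictFD f ⋙ (isFD k A).ι) :=
    inferInstanceAs (PreservesFiniteLimits ((isFD k B).ι ⋙ restrictRight f))
  ⟨fun _ _ _ => preservesLimitsOfShape_of_reflects_of_preserves _ (isFD k A).ι⟩

lemma restrictFD_preservesFiniteColimits (f : A →ₐ[k] B) :
    PreservesFiniteColimits (restrictFD f) :=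
  have := (restrictRight_exact f).2
  have := (isFD_ι_exact k B).2
  have : PreservesFiniteColimits (restrictFD f ⋙ (isFD k A).ι) :=
    inferInstanceAs (PreservesFiniteColimits ((isFD k B).ι ⋙ restrictRight f))
  ⟨fun _ _ _ => preservesColimitsOfShape_of_reflects_of_preserves _ (isFD k A).ι⟩

/-- Restriction along a composite is the composite of the restrictions. -/
def restrictFDComp {C : Type u} [Ring C] [Algebra k C] (f : A →ₐ[k] B) (g : B →ₐ[k] C) :
    restrictFD (g.comp f) ≅ restrictFD g ⋙ restrictFD f :=
  NatIso.ofComponents (fun M => (isFD k A).isoMk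
    ((ModuleCat.restrictScalarsComp' (AlgHom.op f).toRingHom (AlgHom.op g).toRingHom
      (AlgHom.op (g.comp f)).toRingHom rfl).app M.obj)) (fun _ => by ext; rfl)

/-- Restriction along the identity is the identity. -/
def restrictFDId : restrictFD (AlgHom.id k A) ≅ 𝟭 (ModFD k A) :=
  NatIso.ofComponents (fun M => (isFD k A).isoMk
    ((ModuleCat.restrictScalarsId' (AlgHom.op (AlgHom.id k A)).toRingHom rfl).app M.obj))
    (fun _ => by ext; rfl)

/-- If `f = v g v⁻¹` then `x ↦ x v` is an isomorphism `f_* ≅ g_*`. -/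
def restrictFDConj (f g : A →ₐ[k] B) (v : Bˣ) (h : ∀ a, f a = v * g a * (v⁻¹ : Bˣ)) :
    restrictFD f ≅ restrictFD g :=
  NatIso.ofComponents (fun M => (isFD k A).isoMk
    (LinearEquiv.toModuleIso
      (R := Aᵐᵒᵖ) (m₁ := ((restrictRight f).obj M.obj).isModule)
      (m₂ := ((restrictRight g).obj M.obj).isModule)
      { toFun := fun x => (op (v : B) • (show M.obj from x) : M.obj)
        invFun := fun x => (op ((v⁻¹ : Bˣ) : B) • (show M.obj from x) : M.obj)
        map_add' := fun x y => smul_add (A := M.obj) _ _ _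
        map_smul' := fun a x => by
          change op (v : B) • op (f a.unop) • (show M.obj from x) =
            op (g a.unop) • op (v : B) • (show M.obj from x)
          rw [smul_smul, smul_smul, ← op_mul, ← op_mul, h]
          simp [mul_assoc]
        left_inv := fun x => by
          change op ((v⁻¹ : Bˣ) : B) • op (v : B) • (show M.obj from x) = x
          rw [smul_smul, ← op_mul, Units.mul_inv, op_one]
          exact one_smul Bᵐᵒᵖ (show M.obj from x)
        right_inv := fun x => by
          change op (v : B) • op ((v⁻¹ : Bˣ) : B) • (show M.obj from x) = x
          rw [smul_smul, ← op_mul, Units.inv_mul, op_one]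
          exact one_smul Bᵐᵒᵖ (show M.obj from x) }))
    (fun {M N} t => by
      ext x
      exact (t.hom.hom.map_smul (op (v : B)) x).symm)

/-- A character of `A`, as a homomorphism out of `Aᵐᵒᵖ`. -/
def charOp (χ : A →ₐ[k] k) : Aᵐᵒᵖ →ₐ[k] k :=
  χ.fromOpposite fun _ _ => mul_comm _ _

lemma isFD_of_surjective {M : ModuleCat.{u} Aᵐᵒᵖ} (e : k →+ M)
    (he : ∀ c x, e (c * x) = algebraMap k Aᵐᵒᵖ c • e x) (hs : Function.Surjective e) :
    isFD k A M :=
  Module.Finite.of_surjective ({ e with map_smul' := he } : k →ₗ[k] M) hs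

lemma isFD_charModule (χ : A →ₐ[k] k) :
    isFD k A ((ModuleCat.restrictScalars (charOp χ).toRingHom).obj (ModuleCat.of k k)) :=
  isFD_of_surjective (AddMonoidHom.id k)
    (fun c x => congrArg (· * x) ((charOp χ).commutes c).symm) (fun x => ⟨x, rfl⟩)

/-- The one-dimensional right `A`-module `k` on which `A` acts through the character `χ`. -/
def charModule (χ : A →ₐ[k] k) : ModFD k A :=
  ⟨(ModuleCat.restrictScalars (charOp χ).toRingHom).obj (ModuleCat.of k k), isFD_charModule χ⟩

/-- The restriction of the module of a character `χ` is the module of the restricted character. -/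
def restrictFDCharModule (f : A →ₐ[k] B) (χ : B →ₐ[k] k) :
    (restrictFD f).obj (charModule χ) ≅ charModule (χ.comp f) :=
  (isFD k A).isoMk ((ModuleCat.restrictScalarsComp' (AlgHom.op f).toRingHom (charOp χ).toRingHom
    (charOp (χ.comp f)).toRingHom rfl).symm.app (ModuleCat.of k k))

end Modules

/-! ### The functor -/

variable {k : Type u} [Field k] {n : ℕ}

/-- The category `mod_fd-A` of finite-dimensional right `A`-modules, together with the isomorphism
classes of the modules given by the characters of `A`. -/
def modFD (A : Bas k n) : MarkedCat k n where
  carrier := ModFD k A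
  marking i := isoClass (charModule (A.char i))

/-- The restriction functor along a compatible homomorphism. -/
def restrict {A B : Bas k n} (f : Bas.AlgHomOver A B) :
    MarkedCat.ExactFun (modFD B) (modFD A) where
  functor := restrictFD f.hom
  preservesFiniteLimits := restrictFD_preservesFiniteLimits f.hom
  preservesFiniteColimits := restrictFD_preservesFiniteColimits f.hom
  linear := inferInstanceAs ((restrictFD f.hom).Linear k)
  map_marking i := Quotient.sound
    ⟨restrictFDCharModule f.hom (B.char i) ≪≫ eqToIso (by rw [f.char_comp])⟩

/-- The functor sending `A` to `mod_fd-A` and the class of `f : A → B` to the class of the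
restriction functor `f_* : mod_fd-B ⥤ mod_fd-A`. -/
def modFDFunctor (k : Type u) [Field k] (n : ℕ) : (Bas k n)ᵒᵖ ⥤ MarkedCat k n where
  obj A := modFD A.unop
  map {A B} f := Quotient.map (sa := Bas.conjSetoid B.unop A.unop)
    (sb := MarkedCat.isoSetoid (modFD A.unop) (modFD B.unop)) restrict
    (fun φ ψ ⟨v, hv⟩ => ⟨restrictFDConj φ.hom ψ.hom v hv⟩) f.unop
  map_id A := Quotient.sound ⟨restrictFDId⟩
  map_comp {A B C} f g := by
    obtain ⟨⟨f⟩⟩ := f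
    obtain ⟨⟨g⟩⟩ := g
    exact Quotient.sound ⟨restrictFDComp _ _⟩

end

end PointedDef

namespace PointedDef

/-! ### Characters of a basic algebra -/

section Characters

variable {k : Type u} [Field k] {n : ℕ}

/-! Faithful: evaluate an isomorphism `f_* ≅ g_*` at the regular module of `B`. Naturality for left
multiplications makes it right multiplication by a unit `v`, and `A`-linearity reads `f a * v = v *
g a` (`conj_of_restrictFD_iso`).

Full: let `F : mod-B ⥤ mod-A` be exact, linear and compatible with the simples. By Yoneda, `v ∈ F B`
gives a natural map `N → F N` of abelian groups. It is bijective on the simple `S_i` once the image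
of `v` in the line `F S_i` is nonzero; one `v` serves all `i`, since a vector space over an infinite
field is not a finite union of proper subspaces. Exactness and induction on dimension spread
bijectivity to every `N` (`isIso_of_isIso_charModule`). At `N = B`, the object `F B` becomes free on
`v` over `B`, so `v·a = f(a)·v` defines `f : A → B` with `F ≅ f_*` (`exists_restrictFD_iso`).

Essentially surjective: the direct sum `Q` of projective covers of the simples
(`exists_projective_cover`) is a projective generator with one-dimensional spaces `Hom(Q, S_i)`. By
Morita theory `Hom(Q, -)` is an equivalence onto `mod-End Q`. The action on `Hom(Q, S_i)` gives the
characters of `End Q`; their common kernel is the radical, so `End Q` is basic.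

Finiteness of `mod-A` rests on eigenvectors: every nonzero module contains the module of some
character (`exists_eigenvector`). -/

/-- Dedekind's independence of characters: a functional vanishing on the range is a linear relation
among distinct multiplicative maps. -/
lemma pi_surjective_of_injective {A : Type*} [Ring A] [Algebra k A] {ι : Type*} [Finite ι]
    {χ : ι → A →ₐ[k] k} (hχ : Function.Injective χ) :
    Function.Surjective (LinearMap.pi fun i => (χ i).toLinearMap) := by
  classical
  have := Fintype.ofFinite ι
  rw [← LinearMap.range_eq_top]
  by_contra h
  obtain ⟨f, hf, hf'⟩ := Submodule.exists_le_ker_of_lt_top _ (lt_top_iff_ne_top.2 h)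
  have hli : LinearIndependent k fun i => ((χ i : A →* k) : A → k) :=
    (linearIndependent_monoidHom A k).comp (fun i => (χ i : A →* k)) fun i j hij =>
      hχ (AlgHom.ext fun a => DFunLike.congr_fun hij a)
  rw [Fintype.linearIndependent_iff] at hli
  refine hf (LinearMap.pi_ext' fun i => LinearMap.ext_ring ?_)
  simp only [LinearMap.coe_comp, Function.comp_apply, LinearMap.coe_single, LinearMap.zero_apply]
  refine hli (fun i => f (Pi.single i 1)) (funext fun a => ?_) i
  have h0 : f (fun i => χ i a) = 0 := hf' ⟨a, rfl⟩
  rw [pi_eq_sum_univ' (fun i => χ i a), map_sum] at h0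
  simp only [map_smul, smul_eq_mul] at h0
  simp only [Finset.sum_apply, Pi.smul_apply, smul_eq_mul, Pi.zero_apply]
  rw [← h0]
  refine Finset.sum_congr rfl fun i _ => ?_
  rw [mul_comm]
  congr 2

lemma char_eq_zero_of_mem_jacobson {A : Type*} [Ring A] [Algebra k A] (χ : A →ₐ[k] k) {a : A}
    (ha : a ∈ Ring.jacobson A) : χ a = 0 := by
  have : RingHomSurjective (χ : A →+* k) := ⟨fun c => ⟨algebraMap k A c, χ.commutes c⟩⟩
  have h := Ring.le_comap_jacobson (χ : A →+* k) ha
  rwa [IsSemisimpleRing.jacobson_eq_bot] at h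

namespace Bas

variable (A : Bas k n)

lemma exists_char_eq (c : Fin n → k) : ∃ a : A, ∀ i, A.char i a = c i := by
  obtain ⟨a, ha⟩ := pi_surjective_of_injective A.char_injective c
  exact ⟨a, fun i => congrFun ha i⟩

/-- The characters induce a surjection `A / rad A → k ^ n`; both sides have dimension `n`, so it is
injective. -/
lemma mem_jacobson_of_char_eq_zero {a : A} (ha : ∀ i, A.char i a = 0) : a ∈ Ring.jacobson A := by
  let φ : A →ₗ[k] (Fin n → k) := LinearMap.pi fun i => (A.char i).toLinearMap
  have hφ : Function.Surjective φ := pi_surjective_of_injective A.char_injective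
  obtain ⟨e⟩ := A.quotient_radical
  let q : (A ⧸ Ring.jacobson A) →ₗ[k] (Fin n → k) :=
    ((Ring.jacobson A).restrictScalars k).liftQ φ (fun x hx => by
      ext i
      exact char_eq_zero_of_mem_jacobson _ hx)
  have hq : Function.Surjective q := fun y => by
    obtain ⟨x, rfl⟩ := hφ y
    exact ⟨Submodule.Quotient.mk x, rfl⟩
  have : Module.Finite k (A ⧸ Ring.jacobson A) := Module.Finite.equiv e.symm.toLinearEquiv
  have hi : Function.Injective q :=
    (LinearMap.injective_iff_surjective_of_finrank_eq_finrank e.toLinearEquiv.finrank_eq).2 hq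
  rw [← Submodule.Quotient.mk_eq_zero]
  refine hi ?_
  rw [map_zero]
  exact funext ha

lemma isNilpotent_jacobson : IsNilpotent (Ring.jacobson (A : Type u)) := by
  have : IsArtinianRing A := IsArtinianRing.of_finite k A
  rw [← Ideal.jacobson_bot]
  exact IsArtinianRing.isNilpotent_jacobson_bot

end Bas

end Characters

/-! ### Finite-dimensional right modules -/

section ModFD

open ModuleCat MulOpposite

variable {k : Type u} [Field k] {A : Type u} [Ring A] [Algebra k A]

namespace ModFD

instance (M : ModFD k A) : Module.Finite k M.obj := M.property

/-- The `k`-linear map underlying a morphism of finite-dimensional modules. -/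
def toLin {M N : ModFD k A} (f : M ⟶ N) : M.obj →ₗ[k] N.obj := f.hom.hom.restrictScalars k

lemma ext_iff {M N : ModFD k A} {f g : M ⟶ N} : f = g ↔ ∀ x : M.obj, f.hom.hom x = g.hom.hom x :=
  ⟨fun h x => h ▸ rfl, fun h => by ext x; exact h x⟩

lemma mono_iff {M N : ModFD k A} (f : M ⟶ N) : Mono f ↔ Function.Injective f.hom.hom := by
  have := (isFD_ι_exact k A).1
  rw [← (isFD k A).ι.mono_map_iff_mono, ModuleCat.mono_iff_injective]
  rfl

lemma epi_iff {M N : ModFD k A} (f : M ⟶ N) : Epi f ↔ Function.Surjective f.hom.hom := by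
  have := (isFD_ι_exact k A).2
  rw [← (isFD k A).ι.epi_map_iff_epi, ModuleCat.epi_iff_surjective]
  rfl

lemma finrank_lt_of_mono {M N : ModFD k A} (f : M ⟶ N) [Mono f] (hf : ¬ IsIso f) :
    Module.finrank k M.obj < Module.finrank k N.obj := by
  have hi : Function.Injective (toLin f) := (mono_iff f).1 inferInstance
  refine lt_of_le_of_ne (LinearMap.finrank_le_finrank_of_injective hi) fun h => hf ?_
  have : Epi f := (epi_iff f).2 ((LinearMap.injective_iff_surjective_of_finrank_eq_finrank h).1 hi)
  exact isIso_of_mono_of_epi f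

lemma finrank_lt_of_epi {M N : ModFD k A} (f : M ⟶ N) [Epi f] (hf : ¬ IsIso f) :
    Module.finrank k N.obj < Module.finrank k M.obj := by
  have hs : Function.Surjective (toLin f) := (epi_iff f).1 inferInstance
  refine lt_of_le_of_ne (LinearMap.finrank_le_finrank_of_surjective hs) fun h => hf ?_
  have : Mono f := (mono_iff f).2
    ((LinearMap.injective_iff_surjective_of_finrank_eq_finrank h.symm).2 hs)
  exact isIso_of_mono_of_epi f

lemma strictMono_finrank_subobject (M : ModFD k A) :
    StrictMono fun P : Subobject M => Module.finrank k (P : ModFD k A).obj := fun P Q h =>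
  finrank_lt_of_mono (Subobject.ofLE P Q h.le) fun _ =>
    h.not_ge (Subobject.le_of_comm (inv (Subobject.ofLE P Q h.le)) (by simp))

instance isArtinianObject (M : ModFD k A) : IsArtinianObject M :=
  ⟨⟨Subrelation.wf (fun {_ _} h => M.strictMono_finrank_subobject h)
    (InvImage.wf (fun P : Subobject M => Module.finrank k (P : ModFD k A).obj) wellFounded_lt)⟩⟩

instance isNoetherianObject (M : ModFD k A) : IsNoetherianObject M := by
  refine ⟨⟨Subrelation.wf (fun {P Q} h => ?_) (InvImage.wf (fun P : Subobject M =>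
    Module.finrank k M.obj - Module.finrank k (P : ModFD k A).obj) wellFounded_lt)⟩⟩
  have h1 := M.strictMono_finrank_subobject h
  have h2 : Module.finrank k (P : ModFD k A).obj ≤ Module.finrank k M.obj :=
    LinearMap.finrank_le_finrank_of_injective (f := toLin P.arrow) ((mono_iff _).1 inferInstance)
  simp only [InvImage] at h1 ⊢
  omega

instance finite_hom (M N : ModFD k A) : Module.Finite k (M ⟶ N) :=
  Module.Finite.of_injective
    ({ toFun := toLin, map_add' := fun _ _ => rfl
       map_smul' := fun _ _ => LinearMap.ext fun _ => rfl } : (M ⟶ N) →ₗ[k] (M.obj →ₗ[k] N.obj))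
    fun _ _ h => ext_iff.2 fun x => LinearMap.congr_fun h x

instance : EssentiallySmall.{u} (ModFD k A) := by
  have h : isFD k A ≤ ModuleCat.isFG Aᵐᵒᵖ := fun M (hM : Module.Finite k M) =>
    Module.Finite.of_restrictScalars_finite k Aᵐᵒᵖ M
  exact essentiallySmall_of_fully_faithful (ObjectProperty.ιOfLE h : _ ⥤ FGModuleCat.{u} Aᵐᵒᵖ)

lemma isFD_of_surjective_of_finite {V : Type*} [AddCommGroup V] [Module k V] [Module.Finite k V]
    {M : ModuleCat.{u} Aᵐᵒᵖ} (e : V →+ M) (he : ∀ (c : k) x, e (c • x) = algebraMap k Aᵐᵒᵖ c • e x)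
    (hs : Function.Surjective e) : isFD k A M :=
  Module.Finite.of_surjective ({ e with map_smul' := he } : V →ₗ[k] M) hs

variable [Module.Finite k A]

variable (k A) in
/-- The right regular module. -/
def regular : ModFD k A :=
  ⟨ModuleCat.of Aᵐᵒᵖ A, isFD_of_surjective_of_finite (V := A) (AddMonoidHom.id A)
    (fun c a => (Algebra.smul_def c a).trans (Algebra.commutes c a)) fun x => ⟨x, rfl⟩⟩

/-- The morphism from the right regular module which sends `1` to a given element. -/
def ofElt {M : ModFD k A} (x : M.obj) : regular k A ⟶ M :=
  ObjectProperty.homMk (ModuleCat.ofHom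
    { toFun := fun a : A => op a • x
      map_add' := fun a b => by rw [MulOpposite.op_add, add_smul]
      map_smul' := fun a b => by
        change op (b * a.unop) • x = a • op b • x
        rw [smul_smul, op_mul, op_unop] })

lemma ofElt_apply {M : ModFD k A} (x : M.obj) (a : A) :
    (ofElt x : regular k A ⟶ M).hom.hom a = op a • x := rfl

lemma ofElt_one {M : ModFD k A} (x : M.obj) :
    (ofElt x : regular k A ⟶ M).hom.hom (1 : A) = x := by
  rw [ofElt_apply, op_one, one_smul]

lemma hom_regular_ext {M : ModFD k A} {f g : regular k A ⟶ M}
    (h : f.hom.hom (1 : A) = g.hom.hom (1 : A)) : f = g := by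
  refine ext_iff.2 fun (a : A) => ?_
  have h1 : a = (op a • (1 : A) : A) := (one_mul a).symm
  rw [h1]
  exact (f.hom.hom.map_smul (op a) (1 : A)).trans
    ((congrArg (op a • ·) h).trans (g.hom.hom.map_smul (op a) (1 : A)).symm)

lemma ofElt_comp {M N : ModFD k A} (x : M.obj) (f : M ⟶ N) :
    (ofElt x : regular k A ⟶ M) ≫ f = ofElt (f.hom.hom x) := by
  apply hom_regular_ext
  rw [ofElt_one]
  exact congrArg f.hom.hom (ofElt_one x)

lemma ofElt_add {M : ModFD k A} (x y : M.obj) :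
    (ofElt (x + y) : regular k A ⟶ M) = ofElt x + ofElt y := by
  apply hom_regular_ext
  rw [ofElt_one]
  exact congrArg₂ (· + ·) (ofElt_one x).symm (ofElt_one y).symm

lemma ofElt_smul {M : ModFD k A} (c : k) (x : M.obj) :
    (ofElt (c • x) : regular k A ⟶ M) = c • ofElt x := by
  apply hom_regular_ext
  rw [ofElt_one]
  exact congrArg (c • ·) (ofElt_one x).symm

instance : Projective (regular k A) where
  factors {E X} f e _ := by
    obtain ⟨y, hy⟩ := (epi_iff e).1 inferInstance (f.hom.hom (1 : A))
    refine ⟨ofElt y, hom_regular_ext ?_⟩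
    rw [ofElt_comp, ofElt_one, hy]

lemma isSeparator_regular : IsSeparator (regular k A) := by
  rw [Preadditive.isSeparator_iff]
  intro X Y f h
  refine ext_iff.2 fun x => ?_
  have h1 := h (ofElt x)
  rw [ofElt_comp] at h1
  rw [← ofElt_one (k := k) (A := A) (f.hom.hom x), h1]
  rfl

end ModFD

end ModFD

lemma projective_biproduct {C : Type*} [Category* C] [Preadditive C] [HasFiniteBiproducts C]
    {ι : Type} [Finite ι] (P : ι → C)
    (hP : ∀ i, Projective (P i)) : Projective (⨁ P) where
  factors f e _ :=
    ⟨biproduct.desc fun b => Projective.factorThru (biproduct.ι P b ≫ f) e, by cat_disch⟩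

/-! ### Modules of characters, and enough projectives -/

section ModFD

open ModuleCat MulOpposite

variable {k : Type u} [Field k] {A : Type u} [Ring A] [Algebra k A]

namespace ModFD

/-- The generator `1` of the one-dimensional module of a character. -/
def charOne (χ : A →ₐ[k] k) : (charModule χ).obj := (1 : k)

lemma op_smul_charModule (χ : A →ₐ[k] k) (a : A) (x : (charModule χ).obj) :
    op a • x = χ a • x :=
  congrArg (· * (show k from x)) ((charOp χ).commutes (χ a)).symm

lemma exists_smul_charOne (χ : A →ₐ[k] k) (x : (charModule χ).obj) :
    ∃ c : k, x = c • charOne χ :=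
  ⟨x, ((congrArg (· * (1 : k)) ((charOp χ).commutes x)).trans (mul_one (show k from x))).symm⟩

lemma charOne_ne_zero (χ : A →ₐ[k] k) : charOne χ ≠ 0 := one_ne_zero (α := k)

lemma hom_op_smul {M N : ModFD k A} (f : M ⟶ N) (a : A) (x : M.obj) :
    f.hom.hom (op a • x) = op a • f.hom.hom x := f.hom.hom.map_smul _ _

lemma hom_smul {M N : ModFD k A} (f : M ⟶ N) (c : k) (x : M.obj) :
    f.hom.hom (c • x) = c • f.hom.hom x := (toLin f).map_smul _ _

lemma smul_charOne_injective (χ : A →ₐ[k] k) :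
    Function.Injective fun c : k => c • charOne χ := fun _ _ h =>
  smul_left_injective k (charOne_ne_zero χ) h

/-- The morphism out of the module of a character given by an eigenvector. -/
lemma exists_hom_charModule {χ : A →ₐ[k] k} {M : ModFD k A} {y : M.obj}
    (hy : ∀ a : A, op a • y = χ a • y) :
    ∃ f : charModule χ ⟶ M, f.hom.hom (charOne χ) = y :=
  ⟨ObjectProperty.homMk (ModuleCat.ofHom (X := (charModule χ).obj) (Y := M.obj)
    { toFun := fun x => (show k from x) • y
      map_add' := fun x x' => add_smul (show k from x) (show k from x') y
      map_smul' := fun a x => by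
        change (χ a.unop * (show k from x)) • y = a • (show k from x) • y
        rw [← op_unop a, smul_comm (op (unop a)), hy, smul_smul, mul_comm, unop_op] }),
    one_smul k y⟩

instance simple_charModule (χ : A →ₐ[k] k) : Simple (charModule χ) where
  mono_isIso_iff_nonzero {Y} f _ := by
    constructor
    · rintro _ rfl
      obtain ⟨y, hy⟩ := (epi_iff (0 : Y ⟶ charModule χ)).1 inferInstance (charOne χ)
      exact charOne_ne_zero χ hy.symm
    · intro hf
      have : Epi f := by
        rw [epi_iff]
        obtain ⟨y, hy⟩ : ∃ y, f.hom.hom y ≠ 0 := by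
          by_contra! h
          exact hf (ext_iff.2 h)
        intro x
        obtain ⟨c, hc⟩ := exists_smul_charOne χ (f.hom.hom y)
        obtain ⟨d, rfl⟩ := exists_smul_charOne χ x
        have hc0 : c ≠ 0 := by
          rintro rfl
          exact hy (by rw [hc, zero_smul])
        refine ⟨(d * c⁻¹) • y, ?_⟩
        rw [hom_smul, hc, smul_smul, inv_mul_cancel_right₀ hc0]
      exact isIso_of_mono_of_epi f

/-- The generator goes to a nonzero multiple of the generator; comparing the action of `a` on both
and cancelling gives `χ a = χ' a`. -/
lemma char_eq_of_iso {χ χ' : A →ₐ[k] k} (e : charModule χ ≅ charModule χ') : χ = χ' := by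
  obtain ⟨c, hc⟩ := exists_smul_charOne χ' (e.hom.hom.hom (charOne χ))
  have hc0 : c ≠ 0 := by
    rintro rfl
    have : Function.Injective e.hom.hom.hom := (mono_iff _).1 inferInstance
    refine charOne_ne_zero χ (this ?_)
    rw [hc, zero_smul, map_zero]
  ext a
  have h : e.hom.hom.hom (op a • charOne χ) = op a • e.hom.hom.hom (charOne χ) := hom_op_smul _ _ _
  rw [op_smul_charModule, hom_smul, op_smul_charModule, hc, smul_smul, smul_smul] at h
  exact mul_right_cancel₀ hc0 (smul_charOne_injective χ' h)

variable [Module.Finite k A]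

lemma exists_epi_of_finite (M : ModFD k A) :
    ∃ (P : ModFD k A) (p : P ⟶ M), Projective P ∧ Epi p := by
  classical
  have := Abelian.hasFiniteBiproducts (C := ModFD k A)
  obtain ⟨m, y, hy⟩ := Module.Finite.exists_fin (R := k) (M := M.obj)
  refine ⟨⨁ fun _ : Fin m => regular k A, biproduct.desc fun i => ofElt (y i),
    projective_biproduct _ fun _ => inferInstanceAs (Projective (regular k A)), ?_⟩
  rw [epi_iff]
  set f : (⨁ fun _ : Fin m => regular k A) ⟶ M := biproduct.desc fun i => ofElt (y i)
  have h : Submodule.span k (Set.range y) ≤ LinearMap.range (toLin f) := by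
    rw [Submodule.span_le]
    rintro _ ⟨i, rfl⟩
    refine ⟨(biproduct.ι (fun _ : Fin m => regular k A) i).hom.hom (1 : A), ?_⟩
    have : biproduct.ι (fun _ : Fin m => regular k A) i ≫ f = ofElt (y i) := by simp [f]
    exact (ext_iff.1 this (1 : A)).trans (ofElt_one (y i))
  rw [hy, top_le_iff] at h
  exact fun x => LinearMap.range_eq_top.1 h x

end ModFD

end ModFD

/-- In the long exact sequence of `0 → ker p → P → X → 0`, the term `Ext¹(P, Y)` vanishes, so
`Hom(ker p, Y)` maps onto `Ext¹(X, Y)`. -/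
lemma finite_ext_one {k : Type*} [Field k] {C : Type*} [Category* C] [Abelian C] [Linear k C]
    [HasExt C]
    (hfin : ∀ X Y : C, Module.Finite k (X ⟶ Y))
    (hproj : ∀ X : C, ∃ (P : C) (p : P ⟶ X), Projective P ∧ Epi p) (X Y : C) :
    Module.Finite k (Abelian.Ext X Y 1) := by
  obtain ⟨P, p, hP, hp⟩ := hproj X
  let S := ShortComplex.mk _ _ (kernel.condition p)
  have hS : S.ShortExact := { exact := ShortComplex.exact_of_f_is_kernel _ (kernelIsKernel p) }
  have := hfin (kernel p) Y
  let φ : (kernel p ⟶ Y) →ₗ[k] Abelian.Ext X Y 1 :=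
    { toFun := fun f => hS.extClass.comp (Abelian.Ext.mk₀ f) (add_zero 1)
      map_add' := fun f g => by rw [Abelian.Ext.mk₀_add, Abelian.Ext.comp_add]
      map_smul' := fun c f => by
        rw [Abelian.Ext.mk₀_smul, Abelian.Ext.comp_smul, RingHom.id_apply] }
  refine Module.Finite.of_surjective φ fun x => ?_
  have : Projective S.X₂ := hP
  obtain ⟨y, hy⟩ := Abelian.Ext.contravariant_sequence_exact₃ hS Y x
    (Abelian.Ext.eq_zero_of_projective _) (n₀ := 0) rfl
  obtain ⟨f, rfl⟩ := (Abelian.Ext.mk₀_bijective (kernel p) Y).2 y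
  exact ⟨f, hy⟩

/-! ### Eigenvectors, simple modules and finiteness -/

section IsFinite

open MulOpposite ModuleCat

variable {k : Type u} [Field k] {n : ℕ}

namespace ModFD

/-- The radical is nilpotent. If `m + 1` is the least exponent whose power of the radical kills `M`,
any nonzero `x·a` with `a` in the `m`-th power will do. -/
lemma exists_op_smul_jacobson_eq_zero (A : Bas k n) (M : ModFD k A) (hM : ¬ IsZero M) :
    ∃ x : M.obj, x ≠ 0 ∧ ∀ a ∈ Ring.jacobson A, op a • x = 0 := by
  classical
  have hex : ∃ m, ∀ a ∈ Ring.jacobson (A : Type u) ^ m, ∀ x : M.obj, op a • x = 0 := by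
    obtain ⟨m, hm⟩ := A.isNilpotent_jacobson
    refine ⟨m, fun a ha x => ?_⟩
    rw [hm] at ha
    rw [show a = 0 from ha, MulOpposite.op_zero, zero_smul]
  obtain ⟨m, hm⟩ : ∃ m, Nat.find hex = m + 1 := by
    refine Nat.exists_eq_succ_of_ne_zero fun h0 => hM ?_
    rw [IsZero.iff_id_eq_zero, ext_iff]
    intro x
    have h := Nat.find_spec hex 1 (by rw [h0, Submodule.pow_zero, Ideal.one_eq_top]; trivial) x
    rwa [op_one, one_smul] at h
  have h := Nat.find_min hex (m := m) (by omega)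
  push Not at h
  obtain ⟨a, ha, x, hx⟩ := h
  refine ⟨op a • x, hx, fun b hb => ?_⟩
  rw [smul_smul, ← op_mul]
  refine Nat.find_spec hex _ ?_ x
  rw [hm, Submodule.pow_succ]
  exact Ideal.mul_mem_mul ha hb

/-- On a vector `x` killed by the radical, `A` acts through `k ^ n`. For lifts `e i` of the standard
idempotents, `x` is the sum of the `x·e i`; a nonzero one is an eigenvector because `e i * a -
α_i(a) e i` lies in the radical. -/
lemma exists_eigenvector (A : Bas k n) (M : ModFD k A) (hM : ¬ IsZero M) :
    ∃ (i : Fin n) (x : M.obj), x ≠ 0 ∧ ∀ a : A, op a • x = A.char i a • x := by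
  classical
  obtain ⟨x, hx, hJ⟩ := exists_op_smul_jacobson_eq_zero A M hM
  choose e he using fun i => A.exists_char_eq (Pi.single i 1)
  have hsum : x = ∑ i, op (e i) • x := by
    have h := hJ (1 - ∑ i, e i) (A.mem_jacobson_of_char_eq_zero fun j => by
      simp [he, Pi.single_apply])
    rw [MulOpposite.op_sub, sub_smul, op_one, one_smul, sub_eq_zero] at h
    rwa [← Finset.sum_smul, ← Finset.op_sum]
  obtain ⟨i, -, hi⟩ := Finset.exists_ne_zero_of_sum_ne_zero (hsum ▸ hx)
  refine ⟨i, op (e i) • x, hi, fun a => ?_⟩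
  have h := hJ (e i * a - A.char i a • e i) (A.mem_jacobson_of_char_eq_zero fun j => by
    by_cases h : j = i
    · subst h; simp [he]
    · simp [he, h])
  rw [MulOpposite.op_sub, sub_smul, sub_eq_zero, MulOpposite.op_smul, smul_assoc] at h
  rw [smul_smul, ← op_mul, h]

end ModFD

lemma modFD_isFinite (A : Bas k n) : (modFD A).IsFinite where
  essentiallySmall := inferInstanceAs (EssentiallySmall.{u} (ModFD k A))
  finite_length X := ⟨ModFD.isNoetherianObject X, ModFD.isArtinianObject X⟩
  finite_hom X Y := ModFD.finite_hom (A := A) X Y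
  finite_ext X Y :=
    letI : HasExt.{u + 1} (ModFD k A) := HasExt.standard _
    finite_ext_one (C := ModFD k A) ModFD.finite_hom ModFD.exists_epi_of_finite X Y
  exists_projective_generator :=
    ⟨ModFD.regular k A, inferInstanceAs (Projective (ModFD.regular k A)), ModFD.isSeparator_regular⟩
  marking_injective i j h := by
    obtain ⟨e⟩ := Quotient.exact h
    exact A.char_injective (ModFD.char_eq_of_iso e)
  simple_iff (X : ModFD k A) := by
    constructor
    · intro hX
      have hX : Simple X := hX
      -- An eigenvector gives a nonzero map between simple objects, hence an isomorphism.
      obtain ⟨i, x, hx, hax⟩ := ModFD.exists_eigenvector A X (Simple.not_isZero X)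
      obtain ⟨f, hf⟩ := ModFD.exists_hom_charModule hax
      have hf0 : f ≠ 0 := by
        rintro rfl
        exact hx hf.symm
      have := isIso_of_hom_simple hf0
      exact ⟨i, Quotient.sound ⟨asIso f⟩⟩
    · rintro ⟨i, h⟩
      obtain ⟨e⟩ := Quotient.exact h
      exact Simple.of_iso (X := X) e.symm

end IsFinite

/-! ### Faithfulness and fullness -/

section FullFaithful

open MulOpposite ModuleCat

variable {k : Type u} [Field k] {n : ℕ}

lemma conj_of_restrictFD_iso {A B : Bas k n} (f g : Bas.AlgHomOver A B)
    (e : restrictFD f.hom ≅ restrictFD g.hom) : Bas.Conj f g := by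
  let R := ModFD.regular k B
  let t : B → B := fun b => (e.hom.app R).hom.hom b
  let s : B → B := fun b => (e.inv.app R).hom.hom b
  -- Naturality with respect to left multiplication by `b`, an endomorphism of the right regular
  -- module.
  have ht (b : B) : t b = b * t 1 := by
    have h : t (b * 1) = b * t 1 :=
      ModFD.ext_iff.1 (e.hom.naturality (ModFD.ofElt (M := R) b)) (1 : B)
    rwa [mul_one] at h
  have hs (b : B) : s b = b * s 1 := by
    have h : s (b * 1) = b * s 1 :=
      ModFD.ext_iff.1 (e.inv.naturality (ModFD.ofElt (M := R) b)) (1 : B)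
    rwa [mul_one] at h
  have hst (b : B) : s (t b) = b := ModFD.ext_iff.1 (e.hom_inv_id_app R) b
  have hts (b : B) : t (s b) = b := ModFD.ext_iff.1 (e.inv_hom_id_app R) b
  let v : (B : Type u)ˣ := ⟨t 1, s 1, by rw [← hs, hst], by rw [← ht, hts]⟩
  refine ⟨v, fun a => ?_⟩
  rw [Units.eq_mul_inv_iff_mul_eq]
  have h : t (1 * f.hom a) = t 1 * g.hom a :=
    ModFD.hom_op_smul (e.hom.app R) a (show ((restrictFD f.hom).obj R).obj from (1 : B))
  rw [one_mul, ht] at h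
  exact h

variable (k) in
/-- The underlying abelian group of a finite-dimensional right module. -/
abbrev forgetAb (A : Type u) [Ring A] [Algebra k A] : ModFD k A ⥤ AddCommGrpCat.{u} :=
  (isFD k A).ι ⋙ forget₂ (ModuleCat.{u} Aᵐᵒᵖ) AddCommGrpCat

lemma forgetAb_exact (A : Type u) [Ring A] [Algebra k A] :
    PreservesFiniteLimits (forgetAb k A) ∧ PreservesFiniteColimits (forgetAb k A) :=
  have := (isFD_ι_exact k A).1
  have := (isFD_ι_exact k A).2
  ⟨comp_preservesFiniteLimits _ _, comp_preservesFiniteColimits _ _⟩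

namespace ModFD

variable {A B : Type u} [Ring A] [Algebra k A] [Ring B] [Algebra k B] [Module.Finite k B]

/-- An element `v` of `F B` gives the natural map `x ↦ F (x̂) v` from `N` to `F N`, where `x̂` is
the morphism from `B` to `N` sending `1` to `x`. -/
def yonedaMap (F : ModFD k B ⥤ ModFD k A) [F.Additive] (v : (F.obj (regular k B)).obj) :
    forgetAb k B ⟶ F ⋙ forgetAb k A where
  app N := AddCommGrpCat.ofHom (X := N.obj) (Y := (F.obj N).obj)
    { toFun := fun x => (F.map (ofElt x)).hom.hom v
      map_zero' := by
        rw [show (ofElt (0 : N.obj) : regular k B ⟶ N) = 0 from hom_regular_ext (ofElt_one _),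
          F.map_zero]
        rfl
      map_add' := fun x y => by
        rw [ofElt_add, F.map_add]
        rfl }
  naturality M N f := by
    ext x
    change (F.map (ofElt (f.hom.hom x))).hom.hom v = (F.map f).hom.hom ((F.map (ofElt x)).hom.hom v)
    rw [← ofElt_comp, F.map_comp]
    rfl

lemma yonedaMap_apply (F : ModFD k B ⥤ ModFD k A) [F.Additive] (v : (F.obj (regular k B)).obj)
    {N : ModFD k B} (x : N.obj) :
    ((yonedaMap F v).app N).hom x = (F.map (ofElt x)).hom.hom v := rfl

end ModFD

/-- Induction on dimension: a nonzero `N` contains the module of a character, the quotient is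
smaller, and the five lemma applies. The values are abelian groups because in the application `N`
has no `A`-action until `f : A → B` is built. -/
lemma isIso_of_isIso_charModule (B : Bas k n) {U V : ModFD k B ⥤ AddCommGrpCat.{u}}
    [U.Additive] [V.Additive]
    [PreservesFiniteLimits U] [PreservesFiniteLimits V] [PreservesFiniteColimits U]
    [PreservesFiniteColimits V] (τ : U ⟶ V) (h : ∀ i, IsIso (τ.app (charModule (B.char i))))
    (N : ModFD k B) : IsIso (τ.app N) := by
  induction hm : Module.finrank k N.obj using Nat.strong_induction_on generalizing N with
  | _ m ih =>
    by_cases hN : IsZero N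
    · have hU : IsZero (U.obj N) := U.map_isZero hN
      have hV : IsZero (V.obj N) := V.map_isZero hN
      rw [hU.eq_of_src (τ.app N) (hU.iso hV).hom]
      infer_instance
    · obtain ⟨i, x, hx, hax⟩ := ModFD.exists_eigenvector B N hN
      obtain ⟨f, hf⟩ := ModFD.exists_hom_charModule hax
      have hf0 : f ≠ 0 := by
        rintro rfl
        exact hx hf.symm
      have := mono_of_nonzero_from_simple hf0
      let S := ShortComplex.mk _ _ (cokernel.condition f)
      have hS : S.ShortExact :=
        { exact := ShortComplex.exact_of_g_is_cokernel _ (cokernelIsCokernel f)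
          mono_f := this }
      refine ShortComplex.isIso₂_of_shortExact_of_isIso₁₃' (S.mapNatTrans τ) (hS.map_of_exact U)
        (hS.map_of_exact V) (h i) (ih _ ?_ (cokernel f) rfl)
      rw [← hm]
      refine ModFD.finrank_lt_of_epi (cokernel.π f) fun _ => hf0 ?_
      rw [← cancel_mono (cokernel.π f), cokernel.condition, zero_comp]

namespace ModFD

/-- The vectors to avoid form finitely many kernels. Each is proper: `B → S_i` is epi, `F` preserves
epimorphisms, and `F S_i ≅ S_i` is nonzero. -/
lemma exists_forall_map_ne_zero [Infinite k] {A B : Bas k n} (F : ModFD k B ⥤ ModFD k A)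
    [PreservesFiniteColimits F]
    (hF : ∀ i, Nonempty (F.obj (charModule (B.char i)) ≅ charModule (A.char i))) :
    ∃ v : (F.obj (regular k B)).obj,
      ∀ i, (F.map (ofElt (charOne (B.char i)))).hom.hom v ≠ 0 := by
  classical
  let p (i : Fin n) : Submodule k (F.obj (regular k B)).obj :=
    LinearMap.ker (toLin (F.map (ofElt (charOne (B.char i)))))
  have hp : ⊤ ∉ Finset.univ.image p := by
    intro h
    obtain ⟨i, -, hi⟩ := Finset.mem_image.1 h
    have : Epi (ofElt (k := k) (A := B) (charOne (B.char i))) := by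
      rw [epi_iff]
      intro x
      obtain ⟨c, rfl⟩ := exists_smul_charOne _ x
      obtain ⟨b, hb⟩ := B.exists_char_eq fun _ => c
      exact ⟨b, by rw [ofElt_apply, op_smul_charModule, hb]⟩
    obtain ⟨e⟩ := hF i
    obtain ⟨y, hy⟩ := (epi_iff (F.map (ofElt (charOne (B.char i))) ≫ e.hom)).1 inferInstance
      (charOne (A.char i))
    have hy0 : toLin (F.map (ofElt (charOne (B.char i)))) y = 0 := by
      rw [LinearMap.ker_eq_top.1 hi, LinearMap.zero_apply]
    refine charOne_ne_zero (A.char i) (hy.symm.trans ?_)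
    exact (congrArg e.hom.hom.hom hy0).trans (map_zero _)
  obtain ⟨v, hv⟩ := (Set.ne_univ_iff_exists_notMem _).1 (Subspace.biUnion_ne_univ_of_top_notMem hp)
  refine ⟨v, fun i hi => hv ?_⟩
  simp only [Set.mem_iUnion]
  exact ⟨p i, Finset.mem_image_of_mem p (Finset.mem_univ i), hi⟩

/-- By linearity of `F` the map sends `c • 1` to `c • w`, where `w` is a nonzero vector of the line
`F S_i`. -/
lemma isIso_yonedaMap_charModule {A B : Bas k n} (F : ModFD k B ⥤ ModFD k A) [F.Additive]
    [F.Linear k] (v : (F.obj (regular k B)).obj) {i : Fin n}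
    (e : F.obj (charModule (B.char i)) ≅ charModule (A.char i))
    (hv : (F.map (ofElt (charOne (B.char i)))).hom.hom v ≠ 0) :
    IsIso ((yonedaMap F v).app (charModule (B.char i))) := by
  set w := (F.map (ofElt (charOne (B.char i)))).hom.hom v with hw
  have key (c : k) : ((yonedaMap F v).app (charModule (B.char i))).hom (c • charOne (B.char i)) =
      c • w := by
    rw [yonedaMap_apply, ofElt_smul, F.map_smul]
    rfl
  have he : Function.Injective e.hom.hom.hom := (mono_iff e.hom).1 inferInstance
  obtain ⟨d, hd⟩ := exists_smul_charOne (A.char i) (e.hom.hom.hom w)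
  have hd0 : d ≠ 0 := by
    rintro rfl
    rw [zero_smul] at hd
    exact hv (he (hd.trans (map_zero _).symm))
  rw [← isIso_iff_of_reflects_iso _ (forget AddCommGrpCat), isIso_iff_bijective]
  constructor
  · intro x y hxy
    obtain ⟨c, rfl⟩ := exists_smul_charOne (B.char i) x
    obtain ⟨c', rfl⟩ := exists_smul_charOne (B.char i) y
    exact congrArg (· • charOne (B.char i))
      (smul_left_injective k hv ((key c).symm.trans (hxy.trans (key c'))))
  · intro y
    obtain ⟨c, hc⟩ := exists_smul_charOne (A.char i) (e.hom.hom.hom y)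
    refine ⟨(c * d⁻¹) • charOne (B.char i), (key _).trans (he ?_)⟩
    rw [hom_smul, hd, hc, smul_smul, inv_mul_cancel_right₀ hd0]

end ModFD

/-- Functoriality makes `F B` a left `B`-module commuting with the right `A`-action. Bijectivity at
`N = B` says it is free on `v`, so `v·a = f(a)·v` has a unique solution `f(a)`. -/
lemma exists_restrictFD_iso {A B : Bas k n} (F : ModFD k B ⥤ ModFD k A) [F.Additive] [F.Linear k]
    [PreservesFiniteLimits F] [PreservesFiniteColimits F]
    (v : (F.obj (ModFD.regular k B)).obj)
    (hv : ∀ N : ModFD k B, IsIso ((ModFD.yonedaMap F v).app N)) :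
    ∃ f : A →ₐ[k] B, Nonempty (restrictFD f ≅ F) := by
  have hb (N : ModFD k B) : Function.Bijective fun x : N.obj => (F.map (ModFD.ofElt x)).hom.hom v :=
    (isIso_iff_bijective ((forget AddCommGrpCat).map ((ModFD.yonedaMap F v).app N))).1 inferInstance
  let t : B ≃ (F.obj (ModFD.regular k B)).obj := Equiv.ofBijective _ (hb (ModFD.regular k B))
  have t_apply (b : B) : t b = (F.map (ModFD.ofElt (M := ModFD.regular k B) b)).hom.hom v := rfl
  have t_one : t 1 = v := by
    have h : ModFD.ofElt (M := ModFD.regular k B) (1 : B) = 𝟙 (ModFD.regular k B) :=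
      ModFD.hom_regular_ext (ModFD.ofElt_one _)
    rw [t_apply, h, F.map_id]
    rfl
  have smul_apply {N : ModFD k B} (b : B) (x : N.obj) :
      (F.map (ModFD.ofElt (op b • x))).hom.hom v = (F.map (ModFD.ofElt x)).hom.hom (t b) := by
    have h : ModFD.ofElt (op b • x) = ModFD.ofElt (M := ModFD.regular k B) b ≫ ModFD.ofElt x :=
      (ModFD.ofElt_comp (M := ModFD.regular k B) b (ModFD.ofElt x)).symm
    rw [h, F.map_comp]
    rfl
  have t_mul (b b' : B) : t (b * b') =
      (F.map (ModFD.ofElt (M := ModFD.regular k B) b)).hom.hom (t b') := 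
    smul_apply (N := ModFD.regular k B) b' b
  have t_add (b b' : B) : t (b + b') = t b + t b' :=
    ((ModFD.yonedaMap F v).app (ModFD.regular k B)).hom.map_add b b'
  have t_smul (c : k) (b : B) : t (algebraMap k B c * b) = c • t b := by
    have h : ModFD.ofElt (M := ModFD.regular k B) (algebraMap k B c * b) =
        c • ModFD.ofElt (M := ModFD.regular k B) b :=
      (congrArg (ModFD.ofElt (M := ModFD.regular k B)) (Algebra.commutes c b)).trans
        (ModFD.ofElt_smul (M := ModFD.regular k B) c b)
    rw [t_apply, h, F.map_smul]
    rfl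
  let f : A →ₐ[k] B :=
    { toFun := fun a => t.symm (op a • v)
      map_one' := by rw [op_one, one_smul, ← t_one, t.symm_apply_apply]
      -- Both sides are `v·a·a'`: the map `F` of left multiplication by `f a` commutes with the
      -- action of `a'` and sends `v` to `v·a`.
      map_mul' := fun a a' => t.injective (by
        rw [t_mul, t.apply_symm_apply, t.apply_symm_apply, ModFD.hom_op_smul, ← t_apply,
          t.apply_symm_apply, smul_smul, ← op_mul])
      map_zero' := t.injective (by
        rw [t.apply_symm_apply, MulOpposite.op_zero, zero_smul]
        exact (by simpa using t_add 0 0 : t 0 = 0).symm)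
      map_add' := fun a a' => t.injective (by
        rw [t_add]
        simp only [t.apply_symm_apply]
        rw [MulOpposite.op_add, add_smul])
      commutes' := fun c => t.injective (by
        rw [t.apply_symm_apply, ← mul_one (algebraMap k B c), t_smul, t_one]
        rfl) }
  have t_f (a : A) : t (f a) = op a • v := t.apply_symm_apply _
  let η : restrictFD f ⟶ F :=
    { app := fun N => ObjectProperty.homMk (ModuleCat.ofHom
        (X := ((restrictFD f).obj N).obj) (Y := (F.obj N).obj)
        { toFun := fun x => (F.map (ModFD.ofElt (show N.obj from x))).hom.hom v
          map_add' := fun x y => ((ModFD.yonedaMap F v).app N).hom.map_add x y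
          map_smul' := fun a x => by
            change (F.map (ModFD.ofElt (op (f a.unop) • (show N.obj from x)))).hom.hom v = _
            rw [smul_apply, t_f, ModFD.hom_op_smul]
            rfl })
      naturality := fun M N g => ModFD.ext_iff.2 fun x =>
        congrArg (fun h => h.hom x) ((ModFD.yonedaMap F v).naturality g) }
  have hη (N : ModFD k B) : IsIso (η.app N) := by
    have : Mono (η.app N) := (ModFD.mono_iff _).2 (hb N).1
    have : Epi (η.app N) := (ModFD.epi_iff _).2 (hb N).2
    exact isIso_of_mono_of_epi _
  have := NatIso.isIso_of_isIso_app η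
  exact ⟨f, ⟨asIso η⟩⟩

lemma exists_restrict_iso [Infinite k] {A B : Bas k n}
    (F : MarkedCat.ExactFun (modFD B) (modFD A)) :
    ∃ f : Bas.AlgHomOver A B, Nonempty ((restrict f).functor ≅ F.functor) := by
  let F' : ModFD k B ⥤ ModFD k A := F.functor
  have : PreservesFiniteLimits F' := F.preservesFiniteLimits
  have : PreservesFiniteColimits F' := F.preservesFiniteColimits
  have : F'.Linear k := F.linear
  have : F'.Additive := Functor.additive_of_preserves_binary_products F'
  have hF (i : Fin n) : Nonempty (F'.obj (charModule (B.char i)) ≅ charModule (A.char i)) :=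
    Quotient.exact (F.map_marking i)
  obtain ⟨v, hv⟩ := ModFD.exists_forall_map_ne_zero F' hF
  have := (forgetAb_exact (k := k) B).1
  have := (forgetAb_exact (k := k) B).2
  have := (forgetAb_exact (k := k) A).1
  have := (forgetAb_exact (k := k) A).2
  have := comp_preservesFiniteLimits F' (forgetAb k A)
  have := comp_preservesFiniteColimits F' (forgetAb k A)
  obtain ⟨f, ⟨e⟩⟩ := exists_restrictFD_iso F' v (isIso_of_isIso_charModule B _ fun i =>
    ModFD.isIso_yonedaMap_charModule F' v (hF i).some (hv i))
  refine ⟨⟨f, fun i => ?_⟩, ⟨e⟩⟩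
  -- The isomorphisms `f_* S_i ≅ F S_i ≅ S_i` force the restricted character to be the `i`-th one.
  exact ModFD.char_eq_of_iso ((restrictFDCharModule f (B.char i)).symm ≪≫
    e.app (charModule (B.char i)) ≪≫ (hF i).some)

end FullFaithful

/-! ### Projective covers of simple objects -/

open Polynomial in
/-- An element of a finite-dimensional algebra has a multiple, in the subalgebra it generates,
which is idempotent and acts as the identity on some power of it. -/
lemma exists_isIdempotentElem_mul {k E : Type*} [Field k] [Ring E] [Algebra k E]
    [Module.Finite k E] (f : E) :
    ∃ (g : E) (m : ℕ), Commute f g ∧ IsIdempotentElem (f * g) ∧ f ^ m * (f * g) = f ^ m := by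
  -- Fitting decomposition: the minimal polynomial is `X ^ m * h` with `X ∤ h`, and the idempotent
  -- is `X ^ (m + 1) * a = 1 - b * h` at `f`. The exponent `m + 1` leaves a factor `X` to split off
  -- even when `m = 0`.
  obtain ⟨h, hh, hX⟩ := exists_eq_pow_rootMultiplicity_mul_and_not_dvd (minpoly k f)
    (minpoly.ne_zero (Algebra.IsIntegral.isIntegral f)) 0
  generalize rootMultiplicity 0 (minpoly k f) = m at hh
  rw [C_0, sub_zero] at hh hX
  obtain ⟨a, b, hab⟩ : IsCoprime (X ^ (m + 1)) h :=
    ((irreducible_X.coprime_iff_not_dvd).2 hX).pow_left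
  have h0 : aeval f (X ^ m * h) = 0 := by rw [← hh, minpoly.aeval]
  have hfg : f * aeval f (X ^ m * a) = aeval f (X ^ (m + 1) * a) := by
    conv_lhs => enter [1]; rw [← aeval_X (R := k) f]
    rw [← map_mul]
    congr 1
    ring
  refine ⟨aeval f (X ^ m * a), m, ?_, ?_, ?_⟩
  · conv_lhs => rw [← aeval_X (R := k) f]
    exact Commute.map (Commute.all X (X ^ m * a)) (aeval f)
  · rw [hfg, IsIdempotentElem, ← map_mul, ← sub_eq_zero, ← map_sub]
    have : X ^ (m + 1) * a * (X ^ (m + 1) * a) - X ^ (m + 1) * a =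
        X ^ m * h * (- (X * a * b)) := by
      linear_combination (X ^ (m + 1) * a) * hab
    rw [this, map_mul, h0, zero_mul]
  · have hfm : f ^ m = aeval f (X ^ m : k[X]) := by rw [map_pow, aeval_X]
    rw [hfg, hfm, ← map_mul, ← sub_eq_zero, ← map_sub]
    have : X ^ m * (X ^ (m + 1) * a) - X ^ m = X ^ m * h * (- b) := by
      linear_combination (X ^ m) * hab
    rw [this, map_mul, h0, zero_mul]

section

universe v w

variable {C : Type v} [Category.{u} C] [Abelian C]

/-- The dimension of `Hom(P, -)` serves as a size. Were the two equal, every `P ⟶ Y` would factor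
through `i` and be killed by `e`, forcing `e = 0`. -/
lemma comp_left_finrank_lt (k : Type w) [Field k] [Linear k C]
    [∀ X Y : C, Module.Finite k (X ⟶ Y)] {P X Y : C} (hP : IsSeparator P) (i : X ⟶ Y) [Mono i]
    {e : Y ⟶ Y}
    (he : e ≠ 0) (hie : i ≫ e = 0) :
    Module.finrank k (P ⟶ X) < Module.finrank k (P ⟶ Y) := by
  have hi : Function.Injective (Linear.rightComp k P i) := fun x y h => (cancel_mono i).1 h
  refine lt_of_le_of_ne (LinearMap.finrank_le_finrank_of_injective hi) fun h => he ?_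
  have hs := (LinearMap.injective_iff_surjective_of_finrank_eq_finrank h).1 hi
  refine (Preadditive.isSeparator_iff P).1 hP e fun x => ?_
  obtain ⟨y, rfl⟩ := hs x
  rw [Linear.rightComp_apply, Category.assoc, hie, comp_zero]

/-- Every simple object has a projective cover: a projective object `P` with an epimorphism to it
through which every morphism from `P` to a simple object factors. -/
lemma exists_projective_cover (k : Type w) [Field k] [Linear k C]
    [∀ X Y : C, Module.Finite k (X ⟶ Y)] {P₀ : C} [Projective P₀] (hP₀ : IsSeparator P₀)
    (S : C) [Simple S] :
    ∃ (P : C) (p : P ⟶ S), Projective P ∧ p ≠ 0 ∧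
      ∀ (T : C) [Simple T] (q : P ⟶ T), ∃ c : S ⟶ T, q = p ≫ c := by
  classical
  -- The cover is a projective with a nonzero map to `S` for which `Hom(P₀, P)` has least dimension;
  -- `P₀` itself is a candidate.
  have hex : ∃ d, ∃ (P : C) (p : P ⟶ S), Projective P ∧ p ≠ 0 ∧ Module.finrank k (P₀ ⟶ P) = d := by
    by_contra! h
    refine id_nonzero S ((Preadditive.isSeparator_iff P₀).1 hP₀ _ fun p => ?_)
    by_contra hp
    rw [Category.comp_id] at hp
    exact h _ P₀ p inferInstance hp rfl
  obtain ⟨P, p, hP, hp, hd⟩ := Nat.find_spec hex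
  refine ⟨P, p, hP, hp, fun T _ q => ?_⟩
  have : Epi p := epi_of_nonzero_to_simple hp
  by_cases hq : kernel.ι p ≫ q = 0
  · exact ⟨Abelian.epiDesc p q hq, (Abelian.comp_epiDesc p q hq).symm⟩
  exfalso
  have : Epi (kernel.ι p ≫ q) := epi_of_nonzero_to_simple hq
  have hq0 : q ≠ 0 := by
    rintro rfl
    exact hq comp_zero
  -- If `q` does not kill `ker p`, it lifts through `ker p ⟶ T` to an endomorphism `f` with `f ≫ p =
  -- 0` and `f ≫ q = q`. Its Fitting idempotent inherits both properties and is nonzero; the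
  -- complementary summand `R` is a smaller projective on which `p` is still nonzero.
  let f : End P := Projective.factorThru q (kernel.ι p ≫ q) ≫ kernel.ι p
  have hfq : f ≫ q = q := by
    change (Projective.factorThru q (kernel.ι p ≫ q) ≫ kernel.ι p) ≫ q = q
    rw [Category.assoc, Projective.factorThru_comp]
  have hfp : f ≫ p = 0 := by
    change (Projective.factorThru q (kernel.ι p ≫ q) ≫ kernel.ι p) ≫ p = 0
    rw [Category.assoc, kernel.condition, comp_zero]
  have : Module.Finite k (End P) := inferInstanceAs (Module.Finite k (P ⟶ P))
  obtain ⟨g, m, hfg, he, hm⟩ := exists_isIdempotentElem_mul (k := k) f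
  have hep : (f * g : End P) ≫ p = 0 := by
    rw [End.mul_def, Category.assoc, hfp, comp_zero]
  have hfm : (f ^ m : End P) ≫ q = q := by
    clear hm
    induction m with
    | zero => rw [pow_zero]; exact Category.id_comp q
    | succ m ih => rw [pow_succ, End.mul_def, Category.assoc, ih, hfq]
  have heq : (f * g : End P) ≫ q = q := by
    have h : (f ^ m * (f * g) : End P) ≫ q = (f ^ m : End P) ≫ q := by rw [hm]
    rwa [End.mul_def, Category.assoc, hfm] at h
  obtain ⟨R, i, r, hir, hri⟩ := IsIdempotentComplete.idempotents_split P (1 - f * g : End P)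
    he.one_sub
  have : IsSplitMono i := ⟨⟨⟨r, hir⟩⟩⟩
  have hlt : Module.finrank k (P₀ ⟶ R) < Module.finrank k (P₀ ⟶ P) := by
    refine comp_left_finrank_lt k hP₀ i (e := (f * g : End P)) ?_ ?_
    · intro h
      rw [h, zero_comp] at heq
      exact hq0 heq.symm
    · have h : i ≫ (1 - f * g : End P) = i := by
        rw [← hri, ← Category.assoc, hir, Category.id_comp]
      have h' : i ≫ (1 - f * g : End P) = i - i ≫ (f * g : End P) :=
        (Preadditive.comp_sub _ _ _).trans (congrArg (· - _) (Category.comp_id i))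
      rw [h'] at h
      exact sub_eq_self.1 h
  refine Nat.find_min hex (hd ▸ hlt)
    ⟨R, i ≫ p, (Retract.mk i r hir).projective, fun h => hp ?_, rfl⟩
  have h1 : (1 - f * g : End P) ≫ p = p := by
    refine (Preadditive.sub_comp _ _ _).trans ?_
    rw [hep, sub_zero]
    exact Category.id_comp p
  rw [← h1, ← hri, Category.assoc, h, comp_zero]

/-- Take a nonzero quotient with `Hom(P, -)` of least dimension. Dividing by a simple subobject
lowers the dimension, so that subobject must be everything. -/
lemma exists_simple_quotient (k : Type w) [Field k] [Linear k C]
    [∀ X Y : C, Module.Finite k (X ⟶ Y)] {P : C} [Projective P] (hP : IsSeparator P)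
    [∀ X : C, IsArtinianObject X] (X : C) (hX : ¬ IsZero X) :
    ∃ (S : C) (q : X ⟶ S), Simple S ∧ Epi q := by
  classical
  have hex : ∃ d, ∃ (S : C) (q : X ⟶ S), Epi q ∧ ¬ IsZero S ∧ Module.finrank k (P ⟶ S) = d :=
    ⟨_, X, 𝟙 X, inferInstance, hX, rfl⟩
  obtain ⟨S, q, hq, hS, hd⟩ := Nat.find_spec hex
  refine ⟨S, q, ?_, hq⟩
  let i := simpleSubobjectArrow hS
  have hi : i ≠ 0 := fun h => Simple.not_isZero (simpleSubobject hS) (IsZero.of_mono_eq_zero i h)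
  by_cases hZ : IsZero (cokernel i)
  · have := Preadditive.epi_of_isZero_cokernel i hZ
    have := isIso_of_mono_of_epi i
    exact Simple.of_iso (asIso i).symm
  · exfalso
    refine Nat.find_min hex (m := Module.finrank k (P ⟶ cokernel i)) ?_
      ⟨_, q ≫ cokernel.π i, epi_comp _ _, hZ, rfl⟩
    rw [← hd]
    have hs : Function.Surjective (Linear.rightComp k P (cokernel.π i)) := fun x =>
      ⟨Projective.factorThru x (cokernel.π i), Projective.factorThru_comp _ _⟩
    refine lt_of_le_of_ne (LinearMap.finrank_le_finrank_of_surjective hs) fun h => hi ?_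
    have hinj := (LinearMap.injective_iff_surjective_of_finrank_eq_finrank h.symm).2 hs
    refine (Preadditive.isSeparator_iff P).1 hP i fun x => hinj ?_
    rw [map_zero, Linear.rightComp_apply, Category.assoc, cokernel.condition, comp_zero]

/-- A projective object with a one-dimensional space of morphisms to each simple object. -/
lemma exists_basic_projective (k : Type w) [Field k] [IsAlgClosed k] [Linear k C]
    [∀ X Y : C, Module.Finite k (X ⟶ Y)] {P₀ : C} [Projective P₀] (hP₀ : IsSeparator P₀)
    {n : ℕ} (S : Fin n → C) [∀ i, Simple (S i)] (hS : ∀ i j, Nonempty (S i ≅ S j) → i = j) :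
    ∃ (Q : C) (p : ∀ i, Q ⟶ S i), Projective Q ∧ (∀ i, p i ≠ 0) ∧
      ∀ i (q : Q ⟶ S i), ∃ c : k, q = c • p i := by
  classical
  choose P p hP hp hfac using fun i => exists_projective_cover k hP₀ (S i)
  have := Abelian.hasFiniteBiproducts (C := C)
  refine ⟨⨁ P, fun i => biproduct.π P i ≫ p i, projective_biproduct P hP, fun i h => hp i ?_,
    fun i q => ?_⟩
  · rw [← biproduct.ι_π_self_assoc P i (p i)]
    exact (congrArg (biproduct.ι P i ≫ ·) h).trans comp_zero
  · obtain ⟨c, hc⟩ := hfac i (S i) (biproduct.ι P i ≫ q)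
    -- Schur's lemma: the `i`-th component is a scalar multiple of `p i`, and the others vanish
    -- because the simples are pairwise non-isomorphic.
    obtain ⟨c, rfl⟩ := endomorphism_simple_eq_smul_id k c
    refine ⟨c, biproduct.hom_ext' _ _ fun j => ?_⟩
    by_cases hij : j = i
    · subst hij
      rw [hc, Linear.comp_smul, Linear.comp_smul, Category.comp_id, biproduct.ι_π_self_assoc]
    · obtain ⟨d, hd⟩ := hfac j (S i) (biproduct.ι P j ≫ q)
      have hd0 : d = 0 := by
        by_contra hd0
        have := isIso_of_hom_simple hd0
        exact hij (hS _ _ ⟨asIso d⟩)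
      rw [hd, hd0, comp_zero, Linear.comp_smul, biproduct.ι_π_ne_assoc _ hij, zero_comp, smul_zero]

/-! ### Projective generators and the radical of their endomorphism rings -/

/-- The image of a nonzero `f` contains a simple subobject; a nonzero map from `Q` to it lifts along
`X ⟶ im f` to a map not killed by `f`. -/
lemma isSeparator_of_hom_simple_ne_zero [∀ X : C, IsArtinianObject X] {Q : C} [Projective Q]
    (hQ : ∀ (S : C) [Simple S], ∃ p : Q ⟶ S, p ≠ 0) : IsSeparator Q := by
  rw [Preadditive.isSeparator_iff]
  intro X Y f h
  by_contra hf
  have hI : ¬ IsZero (Abelian.image f) := fun hz => hf (by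
    rw [← Abelian.image.fac f, hz.eq_of_src (Abelian.image.ι f) 0, comp_zero])
  obtain ⟨p, hp⟩ := hQ (simpleSubobject hI)
  let x : Q ⟶ X := Projective.factorThru (p ≫ simpleSubobjectArrow hI) (Abelian.factorThruImage f)
  have hx : x ≫ f = (p ≫ simpleSubobjectArrow hI) ≫ Abelian.image.ι f := by
    rw [← Projective.factorThru_comp (p ≫ simpleSubobjectArrow hI) (Abelian.factorThruImage f),
      Category.assoc, Abelian.image.fac]
  rw [h x, eq_comm, Category.assoc, ← zero_comp (f := simpleSubobjectArrow hI ≫ Abelian.image.ι f),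
    cancel_mono] at hx
  exact hp hx

/-- Take the `x i` spanning `Hom(Q, X)`: a `g` killing them kills all of `Hom(Q, X)`, hence is zero.
-/
lemma exists_epi_biproduct (k : Type w) [Field k] [Linear k C]
    [∀ X Y : C, Module.Finite k (X ⟶ Y)] [HasFiniteBiproducts C] {Q : C}
    (hQ : IsSeparator Q) (X : C) :
    ∃ (m : ℕ) (x : Fin m → (Q ⟶ X)), Epi (biproduct.desc x) := by
  obtain ⟨m, x, hx⟩ := Module.Finite.exists_fin (R := k) (M := (Q ⟶ X))
  refine ⟨m, x, Preadditive.epi_of_cancel_zero _ fun {Z} g hg =>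
    (Preadditive.isSeparator_iff Q).1 hQ g fun h => ?_⟩
  have hle : Submodule.span k (Set.range x) ≤ LinearMap.ker (Linear.rightComp k Q g) := by
    rw [Submodule.span_le]
    rintro _ ⟨i, rfl⟩
    change x i ≫ g = 0
    rw [← biproduct.ι_desc x i, Category.assoc, hg, comp_zero]
  rw [hx] at hle
  exact hle (Submodule.mem_top : h ∈ ⊤)

/-- Every `1 + g * f` acts as the identity on maps to simples, so its cokernel has no simple
quotient and it is epi. As `Q` is projective it splits, and in the Noetherian ring `End Q` a
one-sided inverse is two-sided. -/
lemma mem_jacobson_of_comp_simple_eq_zero (k : Type w) [Field k] [Linear k C]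
    [∀ X Y : C, Module.Finite k (X ⟶ Y)] [∀ X : C, IsArtinianObject X] {Q : C} [Projective Q]
    (hQ : IsSeparator Q) {f : End Q} (hf : ∀ (S : C) [Simple S] (q : Q ⟶ S), f ≫ q = 0) :
    f ∈ Ring.jacobson (End Q) := by
  rw [← Ideal.jacobson_bot, Ideal.mem_jacobson_iff]
  intro g
  have : Module.Finite k (End Q) := inferInstanceAs (Module.Finite k (Q ⟶ Q))
  have : Epi (1 + g * f : End Q) := by
    refine Preadditive.epi_of_isZero_cokernel _ ?_
    by_contra hZ
    obtain ⟨S, q, hS, hq⟩ := exists_simple_quotient k hQ _ hZ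
    have h0 : (1 + g * f : End Q) ≫ cokernel.π (1 + g * f : End Q) ≫ q = 0 := by
      rw [cokernel.condition_assoc, zero_comp]
    have h1 (r : Q ⟶ S) : (1 + g * f : End Q) ≫ r = r := by
      refine (Preadditive.add_comp _ _ _ _ _ _).trans ?_
      rw [End.mul_def, Category.assoc, hf, add_zero]
      exact Category.id_comp r
    rw [h1] at h0
    exact Simple.not_isZero S (IsZero.of_epi_eq_zero _ h0)
  let s : End Q := Projective.factorThru (𝟙 Q) (1 + g * f : End Q)
  have hs : (1 + g * f) * s = 1 := Projective.factorThru_comp (𝟙 Q) (1 + g * f : End Q)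
  have : IsNoetherianRing (End Q) := IsNoetherianRing.of_finite k (End Q)
  rw [mul_eq_one_comm] at hs
  refine ⟨s, (Submodule.mem_bot _).2 ?_⟩
  rw [sub_eq_zero, add_comm, mul_assoc]
  rwa [mul_add, mul_one] at hs

end

/-- Present `M` as the cokernel of a map `F Y ⟶ F X`. By fullness this map is `F g`, and right
exactness gives `M ≅ F (coker g)`. -/
lemma essSurj_of_exists_epi {C D : Type*} [Category* C] [Category* D] [Abelian C] [Abelian D]
    (F : C ⥤ D) [F.Full] [F.Additive] [PreservesFiniteColimits F]
    (h : ∀ M : D, ∃ (X : C) (p : F.obj X ⟶ M), Epi p) : F.EssSurj where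
  mem_essImage M := by
    obtain ⟨X, p, _⟩ := h M
    obtain ⟨Y, q, _⟩ := h (kernel p)
    obtain ⟨g, hg⟩ := F.map_surjective (q ≫ kernel.ι p)
    exact ⟨cokernel g, ⟨PreservesCokernel.iso F g ≪≫ cokernelIsoOfEq hg ≪≫ cokernelEpiComp _ _ ≪≫
      (cokernelIsCokernel (kernel.ι p)).coconePointUniqueUpToIso
        (Abelian.epiIsCokernelOfKernel (KernelFork.ofι (kernel.ι p) (kernel.condition p))
          (kernelIsKernel p))⟩⟩

/-! ### The functor represented by a projective generator -/

section Coyoneda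

open MulOpposite ModuleCat

universe v

variable {k : Type u} [Field k] {C : Type v} [Category.{u} C] [Abelian C] [Linear k C]

lemma algebraMap_op_smul_hom {Q X : C} (c : k) (x : Q ⟶ X) :
    algebraMap k (End Q)ᵐᵒᵖ c • x = c • x := by
  change (c • 𝟙 Q) ≫ x = c • x
  rw [Linear.smul_comp, Category.id_comp]

/-- The character by which `End Q` acts on a one-dimensional space `Hom(Q, S)`. -/
lemma exists_char_of_hom {Q S : C} {p : Q ⟶ S} (hp : p ≠ 0) (h : ∀ q : Q ⟶ S, ∃ c : k, q = c • p) :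
    ∃ χ : End Q →ₐ[k] k, ∀ a : End Q, a ≫ p = χ a • p := by
  choose χ hχ using fun a : Q ⟶ Q => h (a ≫ p)
  have hinj : Function.Injective fun c : k => c • p := smul_left_injective k hp
  refine ⟨
    { toFun := χ
      map_one' := hinj ((hχ (𝟙 Q)).symm.trans (by simp))
      map_mul' := fun a b => hinj ((hχ (b ≫ a)).symm.trans (by
        rw [Category.assoc, hχ a, Linear.comp_smul, hχ b, smul_smul]))
      map_zero' := hinj ((hχ 0).symm.trans (by simp))
      map_add' := fun a b => hinj ((hχ (a + b)).symm.trans (by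
        rw [Preadditive.add_comp, hχ a, hχ b]; exact (add_smul _ _ _).symm))
      commutes' := fun c => hinj ((hχ (c • 𝟙 Q)).symm.trans (by
        rw [Linear.smul_comp, Category.id_comp]; rfl)) }, hχ⟩

variable [∀ X Y : C, Module.Finite k (X ⟶ Y)]

instance (Q : C) : Module.Finite k (End Q) := inferInstanceAs (Module.Finite k (Q ⟶ Q))

variable (k) in
lemma isFD_coyoneda (Q X : C) : isFD k (End Q) ((preadditiveCoyonedaObj Q).obj X) :=
  ModFD.isFD_of_surjective_of_finite (V := Q ⟶ X) (M := (preadditiveCoyonedaObj Q).obj X)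
    (AddMonoidHom.id _) (fun c x => (algebraMap_op_smul_hom c x).symm) fun x => ⟨x, rfl⟩

variable (k) in
/-- The functor `Hom(Q, -)` to the finite-dimensional right modules over `End Q`. -/
def coyonedaFD (Q : C) : C ⥤ ModFD k (End Q) :=
  (isFD k (End Q)).lift (preadditiveCoyonedaObj Q) (isFD_coyoneda k Q)

/-- The product `a * b` in `End Q` is `b ≫ a`, which is why precomposition is a right action. -/
lemma coyonedaFD_op_smul (Q : C) {X : C} (a : End Q) (x : Q ⟶ X) :
    (op a • (show ((coyonedaFD k Q).obj X).obj from x)) = (a ≫ x : Q ⟶ X) := rfl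

lemma coyonedaFD_smul (Q : C) {X : C} (c : k) (x : Q ⟶ X) :
    (c • (show ((coyonedaFD k Q).obj X).obj from x)) = (c • x : Q ⟶ X) :=
  algebraMap_op_smul_hom c x

instance (Q : C) : (coyonedaFD k Q).Additive where
  map_add := ModFD.ext_iff.2 fun _ => Preadditive.comp_add _ _ _ _ _ _

instance (Q : C) : (coyonedaFD k Q).Linear k where
  map_smul f c := ModFD.ext_iff.2 fun x =>
    (Linear.comp_smul Q _ _ x c f).trans (coyonedaFD_smul Q c (x ≫ f)).symm

instance (Q : C) [Projective Q] : PreservesFiniteColimits (coyonedaFD k Q) :=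
  have := (isFD_ι_exact k (End Q)).2
  have : PreservesFiniteColimits (coyonedaFD k Q ⋙ (isFD k (End Q)).ι) :=
    inferInstanceAs (PreservesFiniteColimits (preadditiveCoyonedaObj Q))
  ⟨fun _ _ _ => preservesColimitsOfShape_of_reflects_of_preserves _ (isFD k (End Q)).ι⟩

lemma coyonedaFD_faithful {Q : C} (hQ : IsSeparator Q) : (coyonedaFD k Q).Faithful where
  map_injective {X Y f g} h := (isSeparator_def Q).1 hQ f g fun x => ModFD.ext_iff.1 h x

/-- Cover `X` by `Q ^ m` through maps `x i`. The maps `t (x i)` assemble to `Q ^ m ⟶ Y`, which kills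
the kernel of the cover by `End Q`-linearity of `t`, and so descends to `X`. -/
lemma coyonedaFD_full {Q : C} [Projective Q] (hQ : IsSeparator Q) : (coyonedaFD k Q).Full where
  map_surjective {X Y} φ := by
    have := Abelian.hasFiniteBiproducts (C := C)
    obtain ⟨m, x, hx⟩ := exists_epi_biproduct k hQ X
    let t : (Q ⟶ X) →+ (Q ⟶ Y) := φ.hom.hom.toAddMonoidHom
    have ht (a : Q ⟶ Q) (y : Q ⟶ X) : t (a ≫ y) = a ≫ t y := ModFD.hom_op_smul φ a y
    have key (a : Q ⟶ ⨁ fun _ : Fin m => Q) :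
        a ≫ biproduct.desc (fun i => t (x i)) = t (a ≫ biproduct.desc x) := by
      rw [biproduct.desc_eq, biproduct.desc_eq, Preadditive.comp_sum, Preadditive.comp_sum, map_sum]
      refine Finset.sum_congr rfl fun i _ => ?_
      rw [← Category.assoc, ← Category.assoc, ht]
    have h0 : kernel.ι (biproduct.desc x) ≫ biproduct.desc (fun i => t (x i)) = 0 := by
      refine (Preadditive.isSeparator_iff Q).1 hQ _ fun h => ?_
      rw [← Category.assoc, key, Category.assoc, kernel.condition, comp_zero, map_zero]
    refine ⟨Abelian.epiDesc _ _ h0, ModFD.ext_iff.2 fun y => ?_⟩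
    change (show Q ⟶ X from y) ≫ _ = t y
    rw [← Projective.factorThru_comp (show Q ⟶ X from y) (biproduct.desc x), Category.assoc,
      Abelian.comp_epiDesc, key]

lemma exists_epi_coyonedaFD (Q : C) (M : ModFD k (End Q)) :
    ∃ (X : C) (p : (coyonedaFD k Q).obj X ⟶ M), Epi p := by
  classical
  have := Abelian.hasFiniteBiproducts (C := C)
  obtain ⟨m, y, hy⟩ := Module.Finite.exists_fin (R := k) (M := M.obj)
  -- `Hom(Q, Q)` is the regular module, so `Hom(Q, Q ^ m)` is free of rank `m` and its generators
  -- can be sent to the spanning vectors `y i`.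
  let ρ (i : Fin m) : (coyonedaFD k Q).obj Q ⟶ M :=
    show ModFD.regular k (End Q) ⟶ M from ModFD.ofElt (y i)
  have hρ (i : Fin m) (a : End Q) : (ρ i).hom.hom a = op a • y i := rfl
  let p : (coyonedaFD k Q).obj (⨁ fun _ : Fin m => Q) ⟶ M :=
    ∑ i, (coyonedaFD k Q).map (biproduct.π _ i) ≫ ρ i
  have hι (j : Fin m) : (coyonedaFD k Q).map (biproduct.ι (fun _ : Fin m => Q) j) ≫ p = ρ j := by
    rw [Preadditive.comp_sum, Finset.sum_eq_single j]
    · rw [← Category.assoc, ← Functor.map_comp, biproduct.ι_π_self, CategoryTheory.Functor.map_id,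
        Category.id_comp]
    · intro i _ hij
      rw [← Category.assoc, ← Functor.map_comp, biproduct.ι_π_ne _ hij.symm, Functor.map_zero,
        zero_comp]
    · simp
  refine ⟨_, p, ?_⟩
  have h : Submodule.span k (Set.range y) ≤ LinearMap.range (ModFD.toLin p) := by
    rw [Submodule.span_le]
    rintro _ ⟨i, rfl⟩
    refine ⟨𝟙 Q ≫ biproduct.ι (fun _ : Fin m => Q) i, ?_⟩
    refine (ModFD.ext_iff.1 (hι i) (𝟙 Q)).trans ((hρ i 1).trans ?_)
    rw [op_one, one_smul]
  rw [hy, top_le_iff] at h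
  rw [ModFD.epi_iff]
  exact fun x => LinearMap.range_eq_top.1 h x

lemma coyonedaFD_isEquivalence {Q : C} [Projective Q] (hQ : IsSeparator Q) :
    (coyonedaFD k Q).IsEquivalence :=
  have := coyonedaFD_full (k := k) hQ
  { faithful := coyonedaFD_faithful hQ
    full := this
    essSurj := essSurj_of_exists_epi _ (exists_epi_coyonedaFD Q) }

/-- The vector `p` is an eigenvector for `χ` and spans `Hom(Q, S)`. -/
lemma coyonedaFD_obj_iso_charModule {Q S : C} {p : Q ⟶ S} (hp : p ≠ 0)
    (h : ∀ q : Q ⟶ S, ∃ c : k, q = c • p) {χ : End Q →ₐ[k] k} (hχ : ∀ a : End Q, a ≫ p = χ a • p) :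
    Nonempty ((coyonedaFD k Q).obj S ≅ charModule χ) := by
  obtain ⟨f, hf⟩ := ModFD.exists_hom_charModule (χ := χ) (M := (coyonedaFD k Q).obj S) (y := p)
    fun a => (coyonedaFD_op_smul Q a p).trans ((hχ a).trans (coyonedaFD_smul Q (χ a) p).symm)
  have hf0 : f ≠ 0 := by
    rintro rfl
    exact hp hf.symm
  have := mono_of_nonzero_from_simple hf0
  have : Epi f := by
    rw [ModFD.epi_iff]
    intro q
    obtain ⟨c, hc⟩ := h q
    refine ⟨c • ModFD.charOne χ, ?_⟩
    rw [ModFD.hom_smul, hf]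
    exact (coyonedaFD_smul Q c p).trans hc.symm
  have := isIso_of_mono_of_epi f
  exact ⟨(asIso f).symm⟩

end Coyoneda

/-! ### The equivalence -/

section Equivalence

variable {k : Type u} [Field k] {n : ℕ}

lemma nonempty_quotient_jacobson_algEquiv {A : Type*} [Ring A] [Algebra k A]
    {χ : Fin n → A →ₐ[k] k} (hχ : Function.Injective χ)
    (h : ∀ a, (∀ i, χ i a = 0) → a ∈ Ring.jacobson A) :
    Nonempty ((A ⧸ Ring.jacobson A) ≃ₐ[k] (Fin n → k)) := by
  have hs : Function.Surjective (AlgHom.pi χ) :=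
    pi_surjective_of_injective hχ
  have hk : Ring.jacobson A = RingHom.ker (AlgHom.pi χ) := by
    ext a
    rw [RingHom.mem_ker]
    exact ⟨fun ha => funext fun i => char_eq_zero_of_mem_jacobson (χ i) ha,
      fun ha => h a fun i => congrFun ha i⟩
  exact ⟨(Ideal.quotientEquivAlgOfEq k hk).trans (Ideal.quotientKerAlgEquivOfSurjective hs)⟩

/-- An equivalence which is `k`-linear and compatible with the markings is an isomorphism of marked
categories. -/
lemma MarkedCat.nonempty_iso_of_isEquivalence {C D : MarkedCat k n} (F : C ⥤ D) [F.IsEquivalence]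
    [F.Linear k] (h : ∀ i, mapIsoClass F (C.marking i) = D.marking i) : Nonempty (C ≅ D) := by
  let e : C ≌ D := F.asEquivalence
  have : e.functor.Linear k := inferInstanceAs (F.Linear k)
  let f : ExactFun C D :=
    { functor := e.functor
      preservesFiniteLimits := inferInstance
      preservesFiniteColimits := inferInstance
      linear := inferInstance
      map_marking := h }
  let g : ExactFun D C :=
    { functor := e.inverse
      preservesFiniteLimits := inferInstance
      preservesFiniteColimits := inferInstance
      linear := inferInstance
      map_marking := fun i => by
        rw [← h i, ← mapIsoClass_comp]
        refine Eq.trans ?_ (mapIsoClass_id _)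
        induction C.marking i using Quotient.inductionOn with
        | h X => exact Quotient.sound ⟨e.unitIso.symm.app X⟩ }
  exact ⟨{
    hom := Quotient.mk (isoSetoid C D) f
    inv := Quotient.mk (isoSetoid D C) g
    hom_inv_id := Quotient.sound ⟨e.unitIso.symm⟩
    inv_hom_id := Quotient.sound ⟨e.counitIso⟩ }⟩

lemma exists_modFD_iso [IsAlgClosed k] (C : MarkedCat k n) (hC : C.IsFinite) :
    ∃ A : Bas k n, Nonempty (modFD A ≅ C) := by
  have hfin := hC.finite_hom
  have hart (X : C) : IsArtinianObject X := (hC.finite_length X).2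
  obtain ⟨P₀, _, hP₀⟩ := hC.exists_projective_generator
  choose S hS using fun i => Quotient.exists_rep (C.marking i)
  have hsimple (i : Fin n) : Simple (S i) := (hC.simple_iff _).2 ⟨i, (hS i).symm⟩
  have hinj (i j : Fin n) (h : Nonempty (S i ≅ S j)) : i = j :=
    hC.marking_injective ((hS i).symm.trans ((Quotient.sound h).trans (hS j)))
  have hcover (T : C) [Simple T] : ∃ i, Nonempty (S i ≅ T) := by
    obtain ⟨i, hi⟩ := (hC.simple_iff T).1 inferInstance
    exact ⟨i, Quotient.exact ((hS i).trans hi)⟩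
  obtain ⟨Q, p, _, hp, hfac⟩ := exists_basic_projective k hP₀ S hinj
  have hQ : IsSeparator Q := isSeparator_of_hom_simple_ne_zero fun T _ => by
    obtain ⟨i, ⟨e⟩⟩ := hcover T
    exact ⟨p i ≫ e.hom, fun h => hp i (by rwa [← cancel_mono e.hom, zero_comp])⟩
  choose χ hχ using fun i => exists_char_of_hom (hp i) (hfac i)
  have := coyonedaFD_isEquivalence (k := k) hQ
  have hiso (i : Fin n) : Nonempty ((coyonedaFD k Q).obj (S i) ≅ charModule (χ i)) :=
    coyonedaFD_obj_iso_charModule (hp i) (hfac i) (hχ i)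
  have hχinj : Function.Injective χ := fun i j hij => by
    obtain ⟨e⟩ := hiso i
    obtain ⟨e'⟩ := hiso j
    -- Equal characters give isomorphic images, and a fully faithful functor reflects isomorphism.
    exact hinj i j ⟨(coyonedaFD k Q).preimageIso (e ≪≫ eqToIso (by rw [hij]) ≪≫ e'.symm)⟩
  let A : Bas k n :=
    { carrier := End Q
      -- Every map from `Q` to a simple is, up to isomorphism, a multiple of some `p i`, so it is
      -- killed by any `a` on which all `χ i` vanish; such an `a` lies in the radical.
      quotient_radical := nonempty_quotient_jacobson_algEquiv hχinj fun a ha =>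
        mem_jacobson_of_comp_simple_eq_zero k hQ fun T _ q => by
          obtain ⟨i, ⟨e⟩⟩ := hcover T
          obtain ⟨c, hc⟩ := hfac i (q ≫ e.inv)
          rw [← cancel_mono e.inv, zero_comp, Category.assoc, hc, Linear.comp_smul, hχ, ha,
            zero_smul, smul_zero]
      char := χ
      char_injective := hχinj }
  let F : C ⥤ modFD A := coyonedaFD k Q
  have hF : F.IsEquivalence := this
  have hF' : F.Linear k := inferInstanceAs ((coyonedaFD k Q).Linear k)
  obtain ⟨e⟩ := MarkedCat.nonempty_iso_of_isEquivalence F fun i => by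
    rw [← hS i]
    exact Quotient.sound (hiso i)
  exact ⟨A, ⟨e.symm⟩⟩

lemma modFDFunctor_faithful : (modFDFunctor k n).Faithful where
  map_injective {A B} f g h := by
    obtain ⟨⟨f⟩⟩ := f
    obtain ⟨⟨g⟩⟩ := g
    obtain ⟨e⟩ := Quotient.exact h
    exact Quiver.Hom.unop_inj
      (Quotient.sound (s := Bas.conjSetoid B.unop A.unop) (conj_of_restrictFD_iso f g e))

lemma modFDFunctor_full [Infinite k] : (modFDFunctor k n).Full where
  map_surjective {A B} F := by
    obtain ⟨F⟩ := F
    obtain ⟨f, hf⟩ := exists_restrict_iso F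
    exact ⟨Quiver.Hom.op (Quotient.mk (Bas.conjSetoid B.unop A.unop) f), Quotient.sound hf⟩

end Equivalence

end PointedDef

theorem theorem9p3 (k : Type u) [Field k] [IsAlgClosed k] (n : ℕ) :
    ∃ h : ∀ A : (PointedDef.Bas k n)ᵒᵖ, ((PointedDef.modFDFunctor k n).obj A).IsFinite,
      (ObjectProperty.lift (fun C : PointedDef.MarkedCat k n => C.IsFinite)
        (PointedDef.modFDFunctor k n) h :
          (PointedDef.Bas k n)ᵒᵖ ⥤ PointedDef.FinMarkedCat k n).IsEquivalence := by
  have := IsAlgClosed.instInfinite (K := k)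
  have := PointedDef.modFDFunctor_faithful (k := k) (n := n)
  have := PointedDef.modFDFunctor_full (k := k) (n := n)
  refine ⟨fun A => PointedDef.modFD_isFinite A.unop,
    { faithful := Functor.Faithful.of_comp_iso (ObjectProperty.liftCompιIso _ _ _)
      full := Functor.Full.of_comp_faithful_iso (ObjectProperty.liftCompιIso _ _ _)
      essSurj := ⟨fun C => ?_⟩ }⟩
  obtain ⟨A, ⟨e⟩⟩ := PointedDef.exists_modFD_iso C.obj C.property
  exact ⟨Opposite.op A, ⟨ObjectProperty.isoMk _ e⟩⟩
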